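/- Fix $\lambda\in(0,\infty)$ and $a\in(0,1]$. For $n\in\mathbb N$ let $G_n$ be the Erdős–Rényi random graph on $n$ vertices in which each of the $\binom n2$ possible edges is present independently with probability $p_n=\min\{\lambda/n,1\}$. Let $V_T(G_n)$ be the number of vertices of $G_n$ that are part of a triangle of $G_n$, and let $e(G_n)$ be the number of edges of $G_n$. Then $\mathbb P(V_T(G_n)\ge an)>0$ for all sufficiently large $n$, and, conditionally on $V_T(G_n)\ge an$, $e(G_n)/n$ converges in probability to $a+\lambda/2$: for every $\varepsilon>0$, $$\lim_{n\to\infty}\mathbb P\Big(\Big|\frac{e(G_n)}{n}-\Big(a+\frac{\lambda}{2}\Big)\Big|\ge\varepsilon\;\Big|\;V_T(G_n)\ge an\Big)=0 .$$ -/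

import Mathlib

/-- The set of vertices that are part of a triangle of `G`. -/
def triangleVertices {V : Type*} (G : SimpleGraph V) : Set V :=
  {v | ∃ u w : V, G.Adj v u ∧ G.Adj v w ∧ G.Adj u w}

/-- `V_T(G)`: the number of vertices of `G` that are part of a triangle. -/
noncomputable def numTriangleVertices {V : Type*} (G : SimpleGraph V) : ℕ :=
  (triangleVertices G).ncard

/-- `e(G)`: the number of edges of `G`. -/
noncomputable def numEdges {V : Type*} (G : SimpleGraph V) : ℕ :=
  G.edgeSet.ncard

/-- The edge probability `p_n = lam / n`, truncated to `[0, 1]`. For `lam > 0` the truncation only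
matters for the finitely many `n` with `n < lam`. -/
noncomputable def edgeProb (lam : ℝ) (n : ℕ) : unitInterval :=
  Set.projIcc 0 1 zero_le_one (lam / n)

/-- The law of the Erdős–Rényi random graph `G(n, p_n)` with `p_n = lam / n`, as a measure on the
simple graphs with vertex set `Fin n`. -/
noncomputable def erdosRenyi (lam : ℝ) (n : ℕ) : MeasureTheory.Measure (SimpleGraph (Fin n)) :=
  SimpleGraph.binomialRandom (Fin n) (edgeProb lam n)

/-- The event `V_T(G_n) ≥ a n`. -/
def manyTriangleVertices (a : ℝ) (n : ℕ) : Set (SimpleGraph (Fin n)) :=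
  {G | a * n ≤ numTriangleVertices G}

/-!
Write `N = n.choose 2`, `m = ⌊a n / 3⌋`, and let `D m` be the number of packings of the vertex set by
`m` disjoint triples. The cheapest way to put `a n` vertices into triangles is to plant a packing of
`m` triangles, and the whole proof rests on the fact that this is the only way up to subexponential
factors: for every edge probability `p` of order `1 / n`,

  `ℙ_p(V_T ≥ a n) = exp(o(n)) * D m * p ^ (3 * m)`.

*Lower bound.* Conditionally on containing a given packing, the random graph has `O(1)` further
triangles in expectation, since a triple outside the packing has at most one edge in common with it.
Hence with conditional probability at least `1 / 2` the graph contains only polynomially many packings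
of `m` triangles, and the first moment `D m * p ^ (3 * m)` is at most a polynomial times the
probability that one exists (`card_packings_mul_pow_le`). The rounding error `a n - 3 m` is made up by
adding a single triangle (`bernoulliProb_triVerts_le`).

*Upper bound.* A minimal family of triangles that covers all triangle vertices gives each of its
members a vertex of its own. If `i` members are disjoint from all the others, and `l` are not, then the
cover uses at least `3 i + 2 l + j` edges, where `j ≤ l` is the number of distinct edges opposite to
the chosen vertices of the second kind, and it covers at most `3 i + 5 l / 2` vertices, so that
`6 m ≤ 6 i + 5 l` (`exists_code`). The expected number of such structures is
`D i * p ^ (3 * i)` times at most `exp(θ n) * (C / n) ^ l`, and replacing `D i` by `D m` costs a factor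
`exp(θ n) * (C n) ^ (m - i)`, for any `θ > 0` and `C = C(θ)`. Since `m - i ≤ 5 l / 6`, the powers of
`n` win, and the sum over all `i`, `l` is at most `exp(o(n)) * D m * p ^ (3 * m)`
(`bernoulliProb_triVerts_le_exp_mul`).

*Conclusion.* Weighting graphs by `x ^ e(G)` multiplies the measure by `(1 - p + p x) ^ N` and changes
`p` to `p x / (1 - p + p x)`. As the asymptotics hold for both edge probabilities, with the same `D m`,

  `𝔼[x ^ e(G) | V_T ≥ a n] ≤ (1 - p + p x) ^ (N - 3 m) * x ^ (3 m) * exp(o(n))`,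

and the right side is `exp(n (lam (x - 1) / 2 + a log x + o(1)))`
(`eventually_bernoulliGenFun_triVerts_le`). Chernoff's bound with `x` close to `1` on either side
shows that deviations of `e(G) / n` from `a + lam / 2` are exponentially unlikely.
-/

open Finset

/-! ### Bernoulli random subsets of a finite set -/

/-- The probability, under the product Bernoulli measure with parameter `p` on the subsets of the
finite set `E`, of the event `S`, written as a finite sum. -/
noncomputable def bernoulliProb {α : Type*} (E : Finset α) (p : ℝ) (S : Set (Finset α)) : ℝ :=
  open Classical in
  ∑ X ∈ E.powerset with X ∈ S, p ^ #X * (1 - p) ^ (#E - #X)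

/-- The generating function `x ↦ 𝔼[x ^ #X; X ∈ S]` of the size of a Bernoulli random subset `X` of
`E`, restricted to the event `S`. -/
noncomputable def bernoulliGenFun {α : Type*} (E : Finset α) (p x : ℝ) (S : Set (Finset α)) : ℝ :=
  open Classical in
  ∑ X ∈ E.powerset with X ∈ S, x ^ #X * (p ^ #X * (1 - p) ^ (#E - #X))

section Bernoulli
variable {α : Type*} {E F : Finset α} {p : ℝ} {S T : Set (Finset α)}

lemma weight_nonneg (h0 : 0 ≤ p) (h1 : p ≤ 1) (j k : ℕ) : 0 ≤ p ^ j * (1 - p) ^ k :=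
  mul_nonneg (pow_nonneg h0 _) (pow_nonneg (by linarith) _)

lemma bernoulliProb_nonneg (h0 : 0 ≤ p) (h1 : p ≤ 1) : 0 ≤ bernoulliProb E p S :=
  sum_nonneg fun _ _ ↦ weight_nonneg h0 h1 _ _

lemma bernoulliProb_mono (h0 : 0 ≤ p) (h1 : p ≤ 1) (h : ∀ X ⊆ E, X ∈ S → X ∈ T) :
    bernoulliProb E p S ≤ bernoulliProb E p T := by
  classical
  refine sum_le_sum_of_subset_of_nonneg (fun X hX ↦ ?_) fun _ _ _ ↦ weight_nonneg h0 h1 _ _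
  simp only [mem_filter, mem_powerset] at hX ⊢
  exact ⟨hX.1, h X hX.1 hX.2⟩

/-- The event that the random set contains `F` has probability `p ^ #F`. -/
lemma bernoulliProb_superset (hF : F ⊆ E) : bernoulliProb E p {X | F ⊆ X} = p ^ #F := by
  classical
  have key : bernoulliProb E p {X | F ⊆ X}
      = ∑ Y ∈ (E \ F).powerset, p ^ #F * (p ^ #Y * (1 - p) ^ (#(E \ F) - #Y)) := by
    refine (sum_nbij' (fun Y ↦ F ∪ Y) (fun X ↦ X \ F) ?_ ?_ ?_ ?_ ?_).symm
    · intro Y hY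
      simp only [mem_filter, mem_powerset, Set.mem_ofPred_eq] at hY ⊢
      exact ⟨union_subset hF (hY.trans sdiff_subset), subset_union_left⟩
    · intro X hX
      simp only [mem_filter, mem_powerset, Set.mem_ofPred_eq] at hX ⊢
      exact sdiff_subset_sdiff hX.1 le_rfl
    · intro Y hY
      rw [mem_powerset] at hY
      exact union_sdiff_cancel_left (disjoint_of_subset_right hY disjoint_sdiff)
    · intro X hX
      simp only [mem_filter, mem_powerset, Set.mem_ofPred_eq] at hX
      exact union_sdiff_of_subset hX.2
    · intro Y hY
      rw [mem_powerset] at hY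
      rw [card_union_of_disjoint (disjoint_of_subset_right hY disjoint_sdiff),
        card_sdiff_of_subset hF, pow_add, mul_assoc, Nat.sub_sub]
  rw [key, ← mul_sum, sum_pow_mul_eq_add_pow]
  simp

/-- Markov's inequality for the number of events `U i` that occur. For `k = 1` this is the union
bound. -/
lemma mul_bernoulliProb_le_sum {ι : Type*} (s : Finset ι) (U : ι → Set (Finset α)) (k : ℕ)
    (h0 : 0 ≤ p) (h1 : p ≤ 1)
    (h : ∀ X ⊆ E, X ∈ S → ∃ s' ⊆ s, k ≤ #s' ∧ ∀ i ∈ s', X ∈ U i) :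
    k * bernoulliProb E p S ≤ ∑ i ∈ s, bernoulliProb E p (U i) := by
  classical
  simp only [bernoulliProb, sum_filter]
  rw [sum_comm, mul_sum]
  refine sum_le_sum fun X hX ↦ ?_
  rw [mem_powerset] at hX
  have hw : 0 ≤ p ^ #X * (1 - p) ^ (#E - #X) := weight_nonneg h0 h1 _ _
  rw [← sum_filter, sum_const, nsmul_eq_mul]
  split_ifs with hS
  · obtain ⟨s', hs', hk, hU⟩ := h X hX hS
    have : s' ⊆ s.filter fun i ↦ X ∈ U i := fun i hi ↦ mem_filter.2 ⟨hs' hi, hU i hi⟩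
    have : k ≤ #(s.filter fun i ↦ X ∈ U i) := hk.trans (card_le_card this)
    gcongr
  · rw [mul_zero]
    positivity

/-- If at most `k` of the events `U i ⊆ S` occur simultaneously, then their probabilities sum to
at most `k` times the probability of `S`. -/
lemma sum_bernoulliProb_le_mul {ι : Type*} (s : Finset ι) (U : ι → Set (Finset α)) (k : ℕ)
    (h0 : 0 ≤ p) (h1 : p ≤ 1) (hU : ∀ i ∈ s, ∀ X ⊆ E, X ∈ U i → X ∈ S)
    (h : ∀ X ⊆ E, ∀ s' ⊆ s, (∀ i ∈ s', X ∈ U i) → #s' ≤ k) :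
    ∑ i ∈ s, bernoulliProb E p (U i) ≤ k * bernoulliProb E p S := by
  classical
  simp only [bernoulliProb, sum_filter]
  rw [sum_comm, mul_sum]
  refine sum_le_sum fun X hX ↦ ?_
  rw [mem_powerset] at hX
  have hw : 0 ≤ p ^ #X * (1 - p) ^ (#E - #X) := weight_nonneg h0 h1 _ _
  rw [← sum_filter, sum_const, nsmul_eq_mul]
  split_ifs with hS
  · have : #(s.filter fun i ↦ X ∈ U i) ≤ k :=
      h X hX _ (filter_subset _ _) fun i hi ↦ (mem_filter.1 hi).2
    gcongr
  · rw [filter_false_of_mem fun i hi hXi ↦ hS (hU i hi X hX hXi)]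
    simp

/-- Exponential tilting: weighting subsets by `x ^ #X` turns the Bernoulli parameter `p` into
`p * x / (1 - p + p * x)`, up to normalisation. -/
lemma bernoulliGenFun_eq {x : ℝ} (hz : 1 - p + p * x ≠ 0) :
    bernoulliGenFun E p x S
      = (1 - p + p * x) ^ #E * bernoulliProb E (p * x / (1 - p + p * x)) S := by
  classical
  rw [bernoulliGenFun, bernoulliProb, mul_sum]
  refine sum_congr rfl fun X hX ↦ ?_
  have hX := card_le_card (mem_powerset.1 (mem_filter.1 hX).1)
  have h1 : 1 - p * x / (1 - p + p * x) = (1 - p) / (1 - p + p * x) := by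
    field_simp; ring
  rw [h1, div_pow, div_pow, ← Nat.add_sub_of_le hX, Nat.add_sub_cancel_left, pow_add]
  field_simp
  rw [mul_pow]
  ring

/-- Markov's inequality for `x ^ #X`. -/
lemma mul_bernoulliProb_le_bernoulliGenFun {x c : ℝ} (hx : 0 ≤ x) (h0 : 0 ≤ p) (h1 : p ≤ 1)
    (hST : S ⊆ T) (hc : ∀ X ∈ S, c ≤ x ^ #X) :
    c * bernoulliProb E p S ≤ bernoulliGenFun E p x T := by
  classical
  rw [bernoulliProb, bernoulliGenFun, mul_sum]
  refine (sum_le_sum fun X hX ↦ mul_le_mul_of_nonneg_right (hc X (mem_filter.1 hX).2)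
    (weight_nonneg h0 h1 _ _)).trans ?_
  refine sum_le_sum_of_subset_of_nonneg (monotone_filter_right _ fun X _ hX ↦ hST hX) fun _ _ _ ↦ ?_
  exact mul_nonneg (pow_nonneg hx _) (weight_nonneg h0 h1 _ _)

/-- Sprinkling: forcing the `k` elements of `H` into the random set costs at most a factor
`2 ^ k / p ^ k`. -/
lemma bernoulliProb_union_le [DecidableEq α] (h0 : 0 < p) (h1 : p ≤ 1) {H : Finset α}
    (hH : H ⊆ E) :
    p ^ #H * bernoulliProb E p {X | X ∪ H ∈ S} ≤ 2 ^ #H * bernoulliProb E p S := by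
  have hcard : (2 : ℝ) ^ #H = #H.powerset := by simp
  rw [hcard, bernoulliProb, bernoulliProb, mul_sum, ← nsmul_eq_mul, smul_sum]
  set w : Finset α → ℝ := fun X ↦ p ^ #X * (1 - p) ^ (#E - #X) with hw
  have hle : ∀ X ⊆ E, p ^ #H * w X ≤ w (X ∪ H) := by
    intro X hX
    have hXH : X ∪ H ⊆ E := union_subset hX hH
    have hc := card_le_card hXH
    have e1 : #X + #(H \ X) = #(X ∪ H) := by
      rw [← card_union_of_disjoint disjoint_sdiff, union_sdiff_self_eq_union]
    have e2 : #(H \ X) ≤ #H := card_le_card sdiff_subset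
    simp only [hw]
    have e3 : #E - #X = #(H \ X) + (#E - #(X ∪ H)) := by omega
    rw [← e1] at *
    rw [e3, pow_add, pow_add]
    have b1 : p ^ #H ≤ p ^ #(H \ X) := pow_le_pow_of_le_one h0.le h1 e2
    have b2 : (1 - p) ^ #(H \ X) ≤ 1 := pow_le_one₀ (by linarith) (by linarith)
    have q1 : 0 ≤ p ^ #X * (1 - p) ^ (#E - (#X + #(H \ X))) := weight_nonneg h0.le h1 _ _
    have q2 : 0 ≤ (1 - p) ^ #(H \ X) := pow_nonneg (by linarith) _
    calc _ = p ^ #H * (1 - p) ^ #(H \ X) * (p ^ #X * (1 - p) ^ (#E - (#X + #(H \ X)))) := by ring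
      _ ≤ p ^ #(H \ X) * 1 * (p ^ #X * (1 - p) ^ (#E - (#X + #(H \ X)))) := by
        gcongr
      _ = _ := by ring
  classical
  calc ∑ X ∈ E.powerset with X ∈ {X | X ∪ H ∈ S}, p ^ #H * w X
      ≤ ∑ X ∈ E.powerset with X ∪ H ∈ S, w (X ∪ H) := by
        refine (sum_congr (by simp) fun _ _ ↦ rfl).trans_le (sum_le_sum fun X hX ↦ hle X ?_)
        exact mem_powerset.1 (mem_filter.1 hX).1
    _ = ∑ X ∈ E.powerset with X ∪ H ∈ S, ∑ Y ∈ E.powerset with Y ∈ S,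
          if Y = X ∪ H then w Y else 0 := by
        refine sum_congr rfl fun X hX ↦ ?_
        rw [mem_filter, mem_powerset] at hX
        rw [sum_ite_eq', if_pos]
        rw [mem_filter, mem_powerset]
        exact ⟨union_subset hX.1 hH, hX.2⟩
    _ = ∑ Y ∈ E.powerset with Y ∈ S, ∑ X ∈ E.powerset with X ∪ H ∈ S,
          if Y = X ∪ H then w Y else 0 := sum_comm
    _ ≤ ∑ Y ∈ E.powerset with Y ∈ S, #H.powerset • w Y := by
        refine sum_le_sum fun Y hY ↦ ?_
        rw [← sum_filter, sum_const]
        refine nsmul_le_nsmul_left (weight_nonneg h0.le h1 _ _) ?_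
        -- a set `X` is recovered from `X ∪ H` and `X ∩ H`
        refine card_le_card_of_injOn (fun X ↦ X ∩ H) (fun X _ ↦ by simp) ?_
        intro X hX X' hX' hXX
        simp only [coe_filter, mem_filter, Set.mem_ofPred_eq] at hX hX' hXX
        ext t
        have k1 : t ∈ X ∪ H ↔ t ∈ X' ∪ H := by rw [← hX.2, ← hX'.2]
        have k2 : t ∈ X ∩ H ↔ t ∈ X' ∩ H := by rw [hXX]
        simp only [mem_union, mem_inter] at k1 k2
        tauto

end Bernoulli

/-! ### Triangles and packings -/

section Triangles
variable {V : Type*}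

/-- Families of pairwise disjoint three-element sets. -/
def IsPacking (I : Finset (Finset V)) : Prop :=
  (∀ T ∈ I, #T = 3) ∧ ∀ T ∈ I, ∀ T' ∈ I, T ≠ T' → Disjoint T T'

lemma IsPacking.eq_of_mem {I : Finset (Finset V)} (hI : IsPacking I) {T T' : Finset V}
    (hT : T ∈ I) (hT' : T' ∈ I) {x : V} (hx : x ∈ T) (hx' : x ∈ T') : T = T' := by
  by_contra h
  exact disjoint_left.1 (hI.2 T hT T' hT' h) hx hx'

lemma IsPacking.subset {I J : Finset (Finset V)} (hI : IsPacking I) (h : J ⊆ I) : IsPacking J :=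
  ⟨fun T hT ↦ hI.1 T (h hT), fun T hT T' hT' ↦ hI.2 T (h hT) T' (h hT')⟩

/-- The packings of `V` by `i` disjoint triples. -/
noncomputable def packings (V : Type*) [Fintype V] (i : ℕ) : Finset (Finset (Finset V)) :=
  open Classical in {I | IsPacking I ∧ #I = i}

lemma mem_packings [Fintype V] {i : ℕ} {I : Finset (Finset V)} :
    I ∈ packings V i ↔ IsPacking I ∧ #I = i := by simp [packings]

variable [DecidableEq V]

/-- The pairs of distinct vertices inside `T`. For a three-element set `T` these are the edges of
the triangle on `T`. -/
def pairsIn (T : Finset V) : Finset (Sym2 V) := {e ∈ T.sym2 | ¬ e.IsDiag}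

lemma mk_mem_pairsIn {T : Finset V} {u v : V} :
    s(u, v) ∈ pairsIn T ↔ u ∈ T ∧ v ∈ T ∧ u ≠ v := by
  simp [pairsIn, and_assoc]

lemma pairsIn_triple {a b c : V} (hab : a ≠ b) (hac : a ≠ c) (hbc : b ≠ c) :
    pairsIn {a, b, c} = {s(a, b), s(a, c), s(b, c)} := by
  ext e
  induction e with | _ u v
  rw [mk_mem_pairsIn]
  simp only [mem_insert, mem_singleton, Sym2.eq_iff]
  grind

lemma card_pairsIn {T : Finset V} (hT : #T = 3) : #(pairsIn T) = 3 := by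
  obtain ⟨a, b, c, hab, hac, hbc, rfl⟩ := card_eq_three.1 hT
  rw [pairsIn_triple hab hac hbc, card_eq_three]
  refine ⟨_, _, _, ?_, ?_, ?_, rfl⟩ <;> simp <;> grind

lemma mem_of_mem_pairsIn {T : Finset V} {e : Sym2 V} (he : e ∈ pairsIn T) {x : V} (hx : x ∈ e) :
    x ∈ T := by
  rw [pairsIn, mem_filter, mem_sym2_iff] at he
  exact he.1 x hx

lemma pairsIn_mono {S T : Finset V} (h : S ⊆ T) : pairsIn S ⊆ pairsIn T := by
  intro e
  induction e with | _ u v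
  simp only [mk_mem_pairsIn]
  exact fun he ↦ ⟨h he.1, h he.2.1, he.2.2⟩

lemma IsPacking.card_biUnion {I : Finset (Finset V)} (hI : IsPacking I) :
    #(I.biUnion id) = 3 * #I := by
  rw [Finset.card_biUnion (t := id) (fun T hT T' hT' h ↦ hI.2 T hT T' hT' h),
    sum_const_nat (f := fun T ↦ #(id T)) (m := 3) hI.1, mul_comm]

lemma IsPacking.card_biUnion_pairsIn {I : Finset (Finset V)} (hI : IsPacking I) :
    #(I.biUnion pairsIn) = 3 * #I := by
  rw [Finset.card_biUnion, sum_congr rfl fun T hT ↦ card_pairsIn (hI.1 T hT)]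
  · simp [mul_comm]
  · intro T hT T' hT' h
    refine disjoint_left.2 fun e ↦ ?_
    induction e with | _ u v
    intro h1 h2
    rw [mk_mem_pairsIn] at h1 h2
    exact h (hI.eq_of_mem hT hT' h1.1 h2.1)

/-- A triple outside a packing has at most one of its edges in a triple of the packing. -/
lemma IsPacking.two_le_card_sdiff {I : Finset (Finset V)} (hI : IsPacking I) {T : Finset V}
    (hT : #T = 3) (hTI : T ∉ I) : 2 ≤ #(pairsIn T \ I.biUnion pairsIn) := by
  have h1 : #(pairsIn T ∩ I.biUnion pairsIn) ≤ 1 := by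
    rw [card_le_one]
    intro e he e' he'
    rw [mem_inter, mem_biUnion] at he he'
    obtain ⟨heT, T₁, hT₁, he₁⟩ := he
    obtain ⟨heT', T₂, hT₂, he₂⟩ := he'
    obtain ⟨a, b, c, hab, hac, hbc, rfl⟩ := card_eq_three.1 hT
    by_contra hne
    have key : ∃ x, x ∈ e ∧ x ∈ e' ∧ ∀ y ∈ ({a, b, c} : Finset V), y ∈ e ∨ y ∈ e' := by
      rw [pairsIn_triple hab hac hbc] at heT heT'
      simp only [mem_insert, mem_singleton] at heT heT'
      rcases heT with rfl | rfl | rfl <;> rcases heT' with rfl | rfl | rfl <;>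
        first
          | exact absurd rfl hne
          | (refine ⟨a, ?_, ?_, ?_⟩ <;> simp; done)
          | (refine ⟨b, ?_, ?_, ?_⟩ <;> simp; done)
          | (refine ⟨c, ?_, ?_, ?_⟩ <;> simp)
    obtain ⟨x, hx, hx', hy⟩ := key
    obtain rfl := hI.eq_of_mem hT₁ hT₂ (mem_of_mem_pairsIn he₁ hx) (mem_of_mem_pairsIn he₂ hx')
    refine hTI ?_
    have : ({a, b, c} : Finset V) ⊆ T₁ := fun y h ↦ (hy y h).elim
      (fun h ↦ mem_of_mem_pairsIn he₁ h) fun h ↦ mem_of_mem_pairsIn he₂ h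
    rwa [eq_of_subset_of_card_le this (by rw [hT, hI.1 _ hT₁])]
  have h2 := card_inter_add_card_sdiff (pairsIn T) (I.biUnion pairsIn)
  rw [card_pairsIn hT] at h2
  omega

variable [Fintype V]

variable (V) in
/-- The edges of the complete graph on `V`. -/
def allPairs : Finset (Sym2 V) := pairsIn univ

lemma card_allPairs : #(allPairs V) = (Fintype.card V).choose 2 := by
  rw [← Sym2.card_subtype_not_diag, Fintype.card_subtype]
  simp [allPairs, pairsIn]

/-- The triangles, as vertex sets, of the graph with edge set `X`. -/
def trianglesOf (X : Finset (Sym2 V)) : Finset (Finset V) :=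
  {T | #T = 3 ∧ pairsIn T ⊆ X}

/-- The vertices that are part of a triangle of the graph with edge set `X`. -/
def triVerts (X : Finset (Sym2 V)) : Finset V := (trianglesOf X).biUnion id

lemma mem_trianglesOf {X : Finset (Sym2 V)} {T : Finset V} :
    T ∈ trianglesOf X ↔ #T = 3 ∧ pairsIn T ⊆ X := by simp [trianglesOf]

lemma mem_triVerts {X : Finset (Sym2 V)} {v : V} :
    v ∈ triVerts X ↔ ∃ T ∈ trianglesOf X, v ∈ T := by simp [triVerts]

lemma triVerts_mono {X Y : Finset (Sym2 V)} (h : X ⊆ Y) : triVerts X ⊆ triVerts Y := by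
  intro v
  simp only [mem_triVerts, mem_trianglesOf]
  exact fun ⟨T, hT, hv⟩ ↦ ⟨T, ⟨hT.1, hT.2.trans h⟩, hv⟩

/-- Adding a triple to a packing, counted from both sides. -/
lemma card_packings_mul_choose_le (i : ℕ) :
    #(packings V i) * (Fintype.card V - 3 * i).choose 3 ≤ (i + 1) * #(packings V (i + 1)) := by
  classical
  have h1 : #((packings V i).sigma fun I ↦ powersetCard 3 (univ \ I.biUnion id))
      = #(packings V i) * (Fintype.card V - 3 * i).choose 3 := by
    rw [card_sigma, sum_const_nat]
    intro I hI
    rw [mem_packings] at hI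
    rw [card_powersetCard, card_sdiff_of_subset (subset_univ _), hI.1.card_biUnion, hI.2, card_univ]
  have h2 : #((packings V (i + 1)).sigma fun J ↦ J) = (i + 1) * #(packings V (i + 1)) := by
    rw [card_sigma, mul_comm, sum_const_nat]
    intro I hI
    exact (mem_packings.1 hI).2
  rw [← h1, ← h2]
  have hnot : ∀ I ∈ packings V i, ∀ T ∈ powersetCard 3 (univ \ I.biUnion id),
      (∀ T' ∈ I, Disjoint T T') ∧ T ∉ I := by
    intro I hI T hT
    rw [mem_powersetCard] at hT
    have : ∀ T' ∈ I, Disjoint T T' := by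
      intro T' hT'
      rw [disjoint_left]
      intro x hx hx'
      have := hT.1 hx
      simp only [mem_sdiff, mem_biUnion, id] at this
      exact this.2 ⟨T', hT', hx'⟩
    refine ⟨this, fun hTI ↦ ?_⟩
    have h3 := this T hTI
    rw [disjoint_self, bot_eq_empty] at h3
    rw [h3] at hT
    simp at hT
  refine card_le_card_of_injOn (fun q ↦ ⟨insert q.2 q.1, q.2⟩) ?_ ?_
  · rintro ⟨I, T⟩ hq
    simp only [coe_sigma, Set.mem_sigma_iff, mem_coe] at hq ⊢
    obtain ⟨hI, hT⟩ := hq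
    obtain ⟨hd, hn⟩ := hnot I hI T hT
    refine ⟨mem_packings.2 ⟨⟨?_, ?_⟩, ?_⟩, mem_insert_self _ _⟩
    · intro T' hT'
      rcases mem_insert.1 hT' with rfl | h
      · exact (mem_powersetCard.1 hT).2
      · exact (mem_packings.1 hI).1.1 T' h
    · intro T₁ h₁ T₂ h₂ hne
      rcases mem_insert.1 h₁ with rfl | k₁ <;> rcases mem_insert.1 h₂ with rfl | k₂
      · exact absurd rfl hne
      · exact hd _ k₂
      · exact (hd _ k₁).symm
      · exact (mem_packings.1 hI).1.2 _ k₁ _ k₂ hne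
    · rw [card_insert_of_notMem hn, (mem_packings.1 hI).2]
  · rintro ⟨I, T⟩ hq ⟨I', T'⟩ hq' h
    simp only [coe_sigma, Set.mem_sigma_iff, mem_coe] at hq hq'
    simp only [Sigma.mk.injEq, heq_eq_eq] at h
    obtain ⟨h, rfl⟩ := h
    have e1 := erase_insert (hnot I hq.1 T hq.2).2
    have e2 := erase_insert (hnot I' hq'.1 T hq'.2).2
    rw [h] at e1
    rw [Sigma.mk.injEq]
    exact ⟨e1.symm.trans e2, HEq.rfl⟩

/-- Iterating `card_packings_mul_choose_le`, with `(n - 3 * i).choose 3` bounded below by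
`(3 * (m - i)).choose 3`. -/
lemma card_packings_mul_factorial_le (d : ℕ) : ∀ i m : ℕ, i + d = m → 3 * m ≤ Fintype.card V →
    #(packings V i) * (3 * d).factorial ≤ #(packings V m) * (6 * m) ^ d := by
  induction d with
  | zero => rintro i m rfl -; simp
  | succ d ih =>
    intro i m him hm
    have h1 := ih (i + 1) m (by omega) hm
    have h2 := card_packings_mul_choose_le (V := V) i
    have h3 : (3 * (d + 1)).choose 3 ≤ (Fintype.card V - 3 * i).choose 3 :=
      Nat.choose_le_choose _ (by omega)
    have h4 : (3 * (d + 1)).factorial = 6 * (3 * (d + 1)).choose 3 * (3 * d).factorial := by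
      rw [← Nat.choose_mul_factorial_mul_factorial (show 3 ≤ 3 * (d + 1) by omega)]
      have : 3 * (d + 1) - 3 = 3 * d := by omega
      rw [this, show Nat.factorial 3 = 6 from rfl]
      ring
    calc #(packings V i) * (3 * (d + 1)).factorial
        = 6 * (#(packings V i) * (3 * (d + 1)).choose 3) * (3 * d).factorial := by rw [h4]; ring
      _ ≤ 6 * (#(packings V i) * (Fintype.card V - 3 * i).choose 3) * (3 * d).factorial := by gcongr
      _ ≤ 6 * ((i + 1) * #(packings V (i + 1))) * (3 * d).factorial := by gcongr
      _ ≤ 6 * (m * #(packings V (i + 1))) * (3 * d).factorial := by gcongr; omega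
      _ = 6 * m * (#(packings V (i + 1)) * (3 * d).factorial) := by ring
      _ ≤ 6 * m * (#(packings V m) * (6 * m) ^ d) := by gcongr
      _ = _ := by ring

/-- The expected number of triangles outside a packing, in the random graph conditioned to contain
the packing, is bounded. -/
lemma IsPacking.sum_pow_card_sdiff_le {I : Finset (Finset V)} (hI : IsPacking I) {p c : ℝ}
    (h0 : 0 ≤ p) (h1 : p ≤ 1) (hc : Fintype.card V * p ≤ c) :
    ∑ T ∈ powersetCard 3 univ \ I, p ^ #(pairsIn T \ I.biUnion pairsIn) ≤ c ^ 3 + c ^ 2 := by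
  set F := I.biUnion pairsIn with hF
  have hn : (0 : ℝ) ≤ Fintype.card V := Nat.cast_nonneg _
  have hcardF : #F ≤ Fintype.card V := by
    rw [hF, hI.card_biUnion_pairsIn, ← hI.card_biUnion]
    exact card_le_univ _
  have hterm : ∀ T ∈ powersetCard 3 univ \ I,
      p ^ #(pairsIn T \ F) ≤ p ^ 3 + ∑ e ∈ F, if e ∈ pairsIn T then p ^ 2 else 0 := by
    intro T hT
    rw [mem_sdiff, mem_powersetCard] at hT
    have hpos : ∀ e ∈ F, 0 ≤ if e ∈ pairsIn T then p ^ 2 else 0 := fun e _ ↦ by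
      split_ifs <;> positivity
    by_cases h : ∃ e ∈ F, e ∈ pairsIn T
    · obtain ⟨e, he, heT⟩ := h
      have := single_le_sum hpos he
      rw [if_pos heT] at this
      have h2 := pow_le_pow_of_le_one h0 h1 (hI.two_le_card_sdiff hT.1.2 hT.2)
      have : 0 ≤ p ^ 3 := by positivity
      linarith
    · push Not at h
      have : pairsIn T \ F = pairsIn T := by
        rw [Finset.sdiff_eq_self_iff_disjoint, disjoint_comm, disjoint_left]
        exact h
      rw [this, card_pairsIn hT.1.2]
      linarith [sum_nonneg hpos]
  have hcount : ∀ e ∈ F, #{T ∈ powersetCard 3 univ \ I | e ∈ pairsIn T} ≤ Fintype.card V := by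
    intro e _
    induction e with | _ u v
    refine (card_le_card (t := univ.image fun w ↦ ({u, v, w} : Finset V)) ?_).trans card_image_le
    intro T hT
    simp only [mem_filter, mem_sdiff, mem_powersetCard, mk_mem_pairsIn] at hT
    obtain ⟨⟨⟨-, hT3⟩, -⟩, hu, hv, huv⟩ := hT
    have h2 : ({u, v} : Finset V) ⊆ T := by
      intro x
      simp only [mem_insert, mem_singleton]
      rintro (rfl | rfl) <;> assumption
    have h3 : #(T \ {u, v}) = 1 := by
      rw [card_sdiff_of_subset h2, hT3, card_pair huv]
    obtain ⟨w, hw⟩ := card_eq_one.1 h3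
    rw [mem_image]
    refine ⟨w, mem_univ _, ?_⟩
    rw [← union_sdiff_of_subset h2, hw]
    ext; simp
  have hall : #(powersetCard 3 (univ : Finset V) \ I) ≤ Fintype.card V ^ 3 := by
    refine (card_le_card sdiff_subset).trans ?_
    rw [card_powersetCard, card_univ]
    exact Nat.choose_le_pow _ _
  calc _ ≤ ∑ T ∈ powersetCard 3 univ \ I,
        (p ^ 3 + ∑ e ∈ F, if e ∈ pairsIn T then p ^ 2 else 0) := sum_le_sum hterm
    _ = #(powersetCard 3 (univ : Finset V) \ I) * p ^ 3
        + ∑ e ∈ F, #{T ∈ powersetCard 3 univ \ I | e ∈ pairsIn T} * p ^ 2 := by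
      rw [sum_add_distrib, sum_comm, sum_const, nsmul_eq_mul]
      congr 1
      refine sum_congr rfl fun e _ ↦ ?_
      rw [← sum_filter, sum_const, nsmul_eq_mul]
    _ ≤ (Fintype.card V ^ 3 : ℕ) * p ^ 3 + ∑ e ∈ F, (Fintype.card V : ℝ) * p ^ 2 := by
      gcongr with e he
      exact_mod_cast hcount e he
    _ ≤ (Fintype.card V * p) ^ 3 + Fintype.card V * (Fintype.card V * p ^ 2) := by
      rw [sum_const, nsmul_eq_mul]
      push_cast
      rw [← mul_pow]
      gcongr
    _ = (Fintype.card V * p) ^ 3 + (Fintype.card V * p) ^ 2 := by ring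
    _ ≤ c ^ 3 + c ^ 2 := by gcongr

lemma pairsIn_subset_allPairs (T : Finset V) : pairsIn T ⊆ allPairs V :=
  pairsIn_mono (subset_univ _)

/-! ### The lower bound for the probability of many triangle vertices -/

/-- The first moment of the number of packings of `m` triangles is, up to a polynomial factor, a
lower bound for the probability that at least `3 * m` vertices lie in triangles. -/
lemma card_packings_mul_pow_le {p c : ℝ} (h0 : 0 ≤ p) (h1 : p ≤ 1)
    (hc : Fintype.card V * p ≤ c) (m K : ℕ) (hK0 : 0 < K) (hK : 2 * (c ^ 3 + c ^ 2) ≤ K) :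
    #(packings V m) * p ^ (3 * m) ≤ 2 * ((m + K : ℕ) : ℝ) ^ K *
      bernoulliProb (allPairs V) p {X | 3 * m ≤ #(triVerts X)} := by
  classical
  set E := allPairs V with hE
  set U : Finset (Finset V) → Set (Finset (Sym2 V)) := fun I ↦
    {X | I.biUnion pairsIn ⊆ X ∧ #(trianglesOf X) ≤ m + K} with hU
  have hFE : ∀ I : Finset (Finset V), I.biUnion pairsIn ⊆ E := fun I ↦
    biUnion_subset.2 fun T _ ↦ pairsIn_subset_allPairs T
  have hsub : ∀ (I : Finset (Finset V)) (X : Finset (Sym2 V)), IsPacking I →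
      I.biUnion pairsIn ⊆ X → I ⊆ trianglesOf X := fun I X hI hIX T hT ↦
    mem_trianglesOf.2 ⟨hI.1 T hT, (subset_biUnion_of_mem pairsIn hT).trans hIX⟩
  have hlow : ∀ I ∈ packings V m, p ^ (3 * m) / 2 ≤ bernoulliProb E p (U I) := by
    intro I hI
    obtain ⟨hI, hIm⟩ := mem_packings.1 hI
    set B : Set (Finset (Sym2 V)) := {X | I.biUnion pairsIn ⊆ X ∧ m + K < #(trianglesOf X)} with hB
    -- Markov's inequality for the number of triangles outside `I`
    have hmark : (K : ℝ) * bernoulliProb E p B ≤ p ^ (3 * m) * (c ^ 3 + c ^ 2) := by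
      refine (mul_bernoulliProb_le_sum (powersetCard 3 univ \ I)
        (fun T ↦ {X | I.biUnion pairsIn ∪ pairsIn T ⊆ X}) K h0 h1 ?_).trans ?_
      · rintro X - ⟨hIX, hX⟩
        refine ⟨trianglesOf X \ I, ?_, ?_, ?_⟩
        · refine sdiff_subset_sdiff (fun T hT ↦ ?_) le_rfl
          exact mem_powersetCard.2 ⟨subset_univ _, (mem_trianglesOf.1 hT).1⟩
        · rw [card_sdiff_of_subset (hsub I X hI hIX)]
          omega
        · intro T hT
          exact union_subset hIX (mem_trianglesOf.1 (mem_sdiff.1 hT).1).2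
      · calc _ = ∑ T ∈ powersetCard 3 univ \ I,
              p ^ (3 * m) * p ^ #(pairsIn T \ I.biUnion pairsIn) := by
              refine sum_congr rfl fun T _ ↦ ?_
              rw [bernoulliProb_superset (union_subset (hFE I) (pairsIn_subset_allPairs T)),
                ← pow_add, ← hIm, ← hI.card_biUnion_pairsIn,
                ← card_union_of_disjoint disjoint_sdiff, union_sdiff_self_eq_union]
          _ ≤ _ := by
              rw [← mul_sum]
              gcongr
              exact hI.sum_pow_card_sdiff_le h0 h1 hc
    have hB0 : 0 ≤ bernoulliProb E p B := bernoulliProb_nonneg h0 h1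
    have hsplit : p ^ (3 * m) ≤ bernoulliProb E p (U I) + bernoulliProb E p B := by
      have := mul_bernoulliProb_le_sum (E := E) (p := p) (S := {X | I.biUnion pairsIn ⊆ X})
        (univ : Finset Bool) (fun b ↦ if b then U I else B) 1 h0 h1 (fun X _ hX ↦ ?_)
      · rw [bernoulliProb_superset (hFE I), hI.card_biUnion_pairsIn, hIm] at this
        simpa using this
      · rcases le_or_gt #(trianglesOf X) (m + K) with h | h
        · exact ⟨{true}, by simp, by simp, by simpa [hU] using ⟨biUnion_subset.1 hX, h⟩⟩
        · exact ⟨{false}, by simp, by simp, by simpa [hB] using ⟨biUnion_subset.1 hX, h⟩⟩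
    have hp : 0 ≤ p ^ (3 * m) := by positivity
    have : bernoulliProb E p B ≤ p ^ (3 * m) / 2 := by
      rw [le_div_iff₀ two_pos, ← mul_le_mul_iff_right₀ (Nat.cast_pos.2 hK0 : (0 : ℝ) < K)]
      nlinarith
    linarith
  have hup : ∑ I ∈ packings V m, bernoulliProb E p (U I) ≤
      ((m + K) ^ K : ℕ) * bernoulliProb E p {X | 3 * m ≤ #(triVerts X)} := by
    refine sum_bernoulliProb_le_mul _ _ _ h0 h1 ?_ ?_
    · rintro I hI X - ⟨hIX, -⟩
      obtain ⟨hI, hIm⟩ := mem_packings.1 hI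
      rw [Set.mem_ofPred_eq, ← hIm, ← hI.card_biUnion]
      exact card_le_card (biUnion_subset_biUnion_of_subset_left _ (hsub I X hI hIX))
    · intro X _ s' hs' hX
      rcases s'.eq_empty_or_nonempty with rfl | ⟨J, hJ⟩
      · simp
      · have : s' ⊆ powersetCard m (trianglesOf X) := fun I hI ↦ by
          obtain ⟨hIp, hIm⟩ := mem_packings.1 (hs' hI)
          exact mem_powersetCard.2 ⟨hsub I X hIp (hX I hI).1, hIm⟩
        calc #s' ≤ (#(trianglesOf X)).choose m := by
              rw [← card_powersetCard]; exact card_le_card this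
          _ ≤ (m + K).choose m := Nat.choose_le_choose _ (hX J hJ).2
          _ = (m + K).choose K := Nat.choose_symm_add
          _ ≤ _ := Nat.choose_le_pow _ _
  have := sum_le_sum hlow
  rw [sum_const, nsmul_eq_mul] at this
  push_cast at hup ⊢
  linarith

/-- Raising the number of triangle vertices by at most three costs only a polynomial factor: it
suffices to add one triangle. -/
lemma bernoulliProb_triVerts_le {p : ℝ} (h0 : 0 < p) (h1 : p ≤ 1) {s t : ℕ} (hst : t ≤ s + 3)
    (ht : t ≤ Fintype.card V) (h3 : 3 ≤ Fintype.card V) :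
    p ^ 3 * bernoulliProb (allPairs V) p {X | s ≤ #(triVerts X)} ≤
      8 * (Fintype.card V : ℝ) ^ 3 * bernoulliProb (allPairs V) p {X | t ≤ #(triVerts X)} := by
  have hun := mul_bernoulliProb_le_sum (E := allPairs V) (p := p) (S := {X | s ≤ #(triVerts X)})
    (powersetCard 3 univ) (fun W ↦ {X | X ∪ pairsIn W ∈ {Y | t ≤ #(triVerts Y)}}) 1 h0.le h1 ?_
  · have hW : ∀ W ∈ powersetCard 3 (univ : Finset V),
        p ^ 3 * bernoulliProb (allPairs V) p {X | X ∪ pairsIn W ∈ {Y | t ≤ #(triVerts Y)}} ≤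
        8 * bernoulliProb (allPairs V) p {X | t ≤ #(triVerts X)} := by
      intro W hW
      have := bernoulliProb_union_le (S := {Y | t ≤ #(triVerts Y)}) h0 h1
        (pairsIn_subset_allPairs W)
      rw [card_pairsIn (mem_powersetCard.1 hW).2] at this
      norm_num at this ⊢
      exact this
    have hsum := sum_le_sum hW
    rw [← mul_sum, sum_const, nsmul_eq_mul, card_powersetCard, card_univ] at hsum
    rw [Nat.cast_one, one_mul] at hun
    have hch : ((Fintype.card V).choose 3 : ℝ) ≤ (Fintype.card V : ℝ) ^ 3 := by
      exact_mod_cast Nat.choose_le_pow _ _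
    have hP : 0 ≤ bernoulliProb (allPairs V) p {X | t ≤ #(triVerts X)} :=
      bernoulliProb_nonneg h0.le h1
    have hp3 : 0 ≤ p ^ 3 := by positivity
    nlinarith [mul_le_mul_of_nonneg_left hun hp3, mul_le_mul_of_nonneg_right hch hP]
  · intro X _ hX
    rw [Set.mem_ofPred_eq] at hX
    have hr : t - #(triVerts X) ≤ #(univ \ triVerts X) := by
      rw [card_sdiff_of_subset (subset_univ _), card_univ]
      omega
    obtain ⟨R, hR, hRc⟩ := exists_subset_card_eq hr
    -- the new triangle contains `R`, a set of missing vertices of the right size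
    obtain ⟨W, hRW, -, hWc⟩ := exists_subsuperset_card_eq (subset_univ R)
      (show #R ≤ 3 by omega) (by rwa [card_univ])
    refine ⟨{W}, by simp [hWc], by simp, fun W' hW' ↦ ?_⟩
    obtain rfl := mem_singleton.1 hW'
    have hsub : triVerts X ∪ R ⊆ triVerts (X ∪ pairsIn W') := by
      refine union_subset (triVerts_mono subset_union_left) fun v hv ↦ ?_
      exact mem_triVerts.2 ⟨W', mem_trianglesOf.2 ⟨hWc, subset_union_right⟩, hRW hv⟩
    have hdis : Disjoint (triVerts X) R :=
      disjoint_of_subset_right hR disjoint_sdiff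
    have := card_le_card hsub
    rw [card_union_of_disjoint hdis] at this
    simp only [Set.mem_ofPred_eq]
    omega

end Triangles

/-! ### Minimal triangle covers -/

section Cover
variable {V : Type*} [DecidableEq V]

/-- In a family of triples each of which has a vertex of its own and meets another member of the
family, the average triple accounts for at most `5 / 2` vertices. -/
lemma two_mul_card_biUnion_le {L : Finset (Finset V)} (h3 : ∀ T ∈ L, #T = 3)
    (hmeet : ∀ T ∈ L, ∃ T' ∈ L, T ≠ T' ∧ ∃ x ∈ T, x ∈ T') : 2 * #(L.biUnion id) ≤ 5 * #L := by
  set deg : V → ℕ := fun w ↦ #{T ∈ L | w ∈ T} with hdeg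
  -- `g w * deg w ≥ 2` for covered `w`, while `g` sums to at most `2 + 2 + 1` over each triple
  set g : V → ℕ := fun w ↦ if 2 ≤ deg w then 1 else 2 with hg
  have h1 : ∀ w ∈ L.biUnion id, 2 ≤ ∑ T ∈ L with w ∈ T, g w := by
    intro w hw
    obtain ⟨T, hT, hwT⟩ := mem_biUnion.1 hw
    have : 1 ≤ deg w := card_pos.2 ⟨T, mem_filter.2 ⟨hT, hwT⟩⟩
    rw [sum_const, smul_eq_mul]
    change 2 ≤ deg w * g w
    simp only [hg]
    split_ifs with h <;> omega
  have h2 : ∀ T ∈ L, ∑ w ∈ T, g w ≤ 5 := by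
    intro T hT
    obtain ⟨T', hT', hne, x, hx, hx'⟩ := hmeet T hT
    have hgx : g x = 1 := by
      have : 2 ≤ deg x := by
        rw [← card_pair hne]
        refine card_le_card fun S hS ↦ ?_
        rcases mem_insert.1 hS with rfl | hS
        · exact mem_filter.2 ⟨hT, hx⟩
        · rw [mem_singleton.1 hS]
          exact mem_filter.2 ⟨hT', hx'⟩
      simp [hg, this]
    have hg2 : ∀ w ∈ T.erase x, g w ≤ 2 := fun w _ ↦ by
      simp only [hg]; split_ifs <;> omega
    rw [← add_sum_erase T g hx, hgx]
    have : ∑ w ∈ T.erase x, g w ≤ #(T.erase x) • 2 := sum_le_card_nsmul _ _ _ hg2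
    rw [card_erase_of_mem hx, h3 T hT] at this
    simp only [smul_eq_mul] at this
    omega
  calc 2 * #(L.biUnion id) = ∑ w ∈ L.biUnion id, 2 := by rw [sum_const, smul_eq_mul, mul_comm]
    _ ≤ ∑ w ∈ L.biUnion id, ∑ T ∈ L with w ∈ T, g w := sum_le_sum h1
    _ = ∑ T ∈ L, ∑ w ∈ T, g w := by
      refine sum_comm' fun w T ↦ ?_
      simp only [mem_biUnion, mem_filter, id]
      grind
    _ ≤ ∑ T ∈ L, 5 := sum_le_sum h2
    _ = 5 * #L := by rw [sum_const, smul_eq_mul, mul_comm]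

/-- A minimal subfamily with the same union: every member has a point of its own. -/
lemma exists_private_cover (𝒯 : Finset (Finset V)) :
    ∃ C ⊆ 𝒯, C.biUnion id = 𝒯.biUnion id ∧
      ∀ T ∈ C, ∃ v ∈ T, ∀ T' ∈ C, v ∈ T' → T' = T := by
  have hne : (𝒯.powerset.filter fun C ↦ C.biUnion id = 𝒯.biUnion id).Nonempty :=
    ⟨𝒯, by simp⟩
  obtain ⟨C, hC, hmin⟩ := exists_min_image _ card hne
  rw [mem_filter, mem_powerset] at hC
  refine ⟨C, hC.1, hC.2, fun T hT ↦ ?_⟩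
  by_contra! h
  have : #C ≤ #(C.erase T) := by
    refine hmin _ (mem_filter.2 ⟨mem_powerset.2 ((erase_subset _ _).trans hC.1), ?_⟩)
    rw [← hC.2]
    refine (biUnion_subset_biUnion_of_subset_left _ (erase_subset _ _)).antisymm fun v hv ↦ ?_
    obtain ⟨S, hS, hvS⟩ := mem_biUnion.1 hv
    by_cases hST : S = T
    · subst hST
      obtain ⟨T', hT', hvT', hne⟩ := h v hvS
      exact mem_biUnion.2 ⟨T', mem_erase.2 ⟨hne, hT'⟩, hvT'⟩
    · exact mem_biUnion.2 ⟨S, mem_erase.2 ⟨hST, hS⟩, hvS⟩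
  rw [card_erase_of_mem hT] at this
  have := card_pos.2 ⟨T, hT⟩
  omega

lemma exists_triple_of_mem {T : Finset V} (hT : #T = 3) {v : V} (hv : v ∈ T) :
    ∃ x y, v ≠ x ∧ v ≠ y ∧ x ≠ y ∧ T = {v, x, y} := by
  have : #(T.erase v) = 2 := by rw [card_erase_of_mem hv, hT]
  obtain ⟨x, y, hxy, h⟩ := card_eq_two.1 this
  have hx : x ∈ T.erase v := by rw [h]; simp
  have hy : y ∈ T.erase v := by rw [h]; simp
  exact ⟨x, y, (ne_of_mem_erase hx).symm, (ne_of_mem_erase hy).symm, hxy, by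
    rw [← h, insert_erase hv]⟩

variable [Fintype V]

/-- The edges of a triangle cover encoded by a packing `I`, a set `D` of edges, and a set `P` of
pairs `(v, d)`, each standing for the triangle with vertex `v` and opposite edge `d`. -/
def codeEdges (I : Finset (Finset V)) (D : Finset (Sym2 V)) (P : Finset (V × Sym2 V)) :
    Finset (Sym2 V) :=
  I.biUnion pairsIn ∪ D ∪ P.biUnion fun q ↦ {e | ∃ x ∈ q.2, e = s(q.1, x)}

/-- Every graph with at least `3 * m` triangle vertices contains the edges of an economical
triangle cover: (at most `m` of) its isolated triangles form the packing `I`, and each of the other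
`#P` triangles has two edges of its own, at a vertex which lies in no other triangle of the cover. -/
lemma exists_code (X : Finset (Sym2 V)) (m : ℕ) (hm : 3 * m ≤ #(triVerts X)) :
    ∃ (I : Finset (Finset V)) (D : Finset (Sym2 V)) (P : Finset (V × Sym2 V)),
      IsPacking I ∧ #I ≤ m ∧ D ⊆ allPairs V ∧ P ⊆ univ ×ˢ D ∧ #D ≤ #P ∧
      #P ≤ Fintype.card V ∧ 6 * m ≤ 6 * #I + 5 * #P ∧ codeEdges I D P ⊆ X ∧
      codeEdges I D P ⊆ allPairs V ∧ 3 * #I + #D + 2 * #P ≤ #(codeEdges I D P) := by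
  obtain ⟨C, hCX, hCU, hC⟩ := exists_private_cover (trianglesOf X)
  have hC3 : ∀ T ∈ C, #T = 3 := fun T hT ↦ (mem_trianglesOf.1 (hCX hT)).1
  have hCE : ∀ T ∈ C, pairsIn T ⊆ X := fun T hT ↦ (mem_trianglesOf.1 (hCX hT)).2
  rcases isEmpty_or_nonempty V with hV | hV
  · have : #(triVerts X) = 0 := by simp [Finset.eq_empty_of_isEmpty]
    have hm0 : m = 0 := by omega
    subst hm0
    exact ⟨∅, ∅, ∅, by simp [IsPacking, codeEdges]⟩
  have hex : ∀ T ∈ C, ∃ v x y, v ≠ x ∧ v ≠ y ∧ x ≠ y ∧ T = {v, x, y} ∧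
      ∀ T' ∈ C, v ∈ T' → T' = T := by
    intro T hT
    obtain ⟨v, hv, h⟩ := hC T hT
    obtain ⟨x, y, h1, h2, h3, h4⟩ := exists_triple_of_mem (hC3 T hT) hv
    exact ⟨v, x, y, h1, h2, h3, h4, h⟩
  choose! v x y hvx hvy hxy hT hpriv using hex
  have hvT : ∀ T ∈ C, v T ∈ T := fun T h ↦ (Finset.ext_iff.1 (hT T h) _).2 (by simp)
  have hxT : ∀ T ∈ C, x T ∈ T := fun T h ↦ (Finset.ext_iff.1 (hT T h) _).2 (by simp)
  have hyT : ∀ T ∈ C, y T ∈ T := fun T h ↦ (Finset.ext_iff.1 (hT T h) _).2 (by simp)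
  have hne : ∀ T ∈ C, ∀ T' ∈ C, v T ∈ T' → T = T' := fun T h T' h' hv ↦ (hpriv T h T' h' hv).symm
  classical
  set I₀ := {T ∈ C | ∀ T' ∈ C, T ≠ T' → Disjoint T T'} with hI₀
  set L := {T ∈ C | ¬ ∀ T' ∈ C, T ≠ T' → Disjoint T T'} with hL
  have hI₀C : I₀ ⊆ C := filter_subset _ _
  have hLC : ∀ T ∈ L, T ∈ C := fun T h ↦ (mem_filter.1 h).1
  have hpack : IsPacking I₀ := ⟨fun T h ↦ hC3 T (hI₀C h), fun T h T' h' hn ↦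
    (mem_filter.1 h).2 T' (hI₀C h') hn⟩
  have hIL : ∀ T ∈ I₀, ∀ T' ∈ L, ∀ w ∈ T', w ∉ T := by
    intro T h T' h' w hw' hw
    have hn : T ≠ T' := by
      rintro rfl
      exact (mem_filter.1 h').2 (mem_filter.1 h).2
    exact disjoint_left.1 ((mem_filter.1 h).2 T' (hLC _ h') hn) hw hw'
  -- only `m` of the isolated triangles are recorded if there are more
  obtain ⟨I, hII, hIc⟩ := exists_subset_card_eq (Nat.min_le_left #I₀ m)
  set D := L.image fun T ↦ s(x T, y T) with hD
  set P := L.image fun T ↦ (v T, s(x T, y T)) with hP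
  set P₁ := L.image fun T ↦ s(v T, x T) with hP₁
  set P₂ := L.image fun T ↦ s(v T, y T) with hP₂
  set A := I.biUnion pairsIn with hA
  have hvinj : Set.InjOn v L := fun T h T' h' e ↦
    hne T (hLC T h) T' (hLC T' h') (by rw [e]; exact hvT T' (hLC T' h'))
  have cP : #P = #L := card_image_of_injOn fun T h T' h' e ↦ hvinj h h' (Prod.ext_iff.1 e).1
  have hmeq : ∀ T ∈ L, ∀ T' ∈ L, ∀ w, v T ∈ s(v T', w) → w ∈ T' → T = T' := by
    intro T h T' h' w hw hwT
    refine hne T (hLC T h) T' (hLC T' h') ?_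
    rcases Sym2.mem_iff.1 hw with e | e <;> rw [e]
    exacts [hvT T' (hLC T' h'), hwT]
  have cP₁ : #P₁ = #L := card_image_of_injOn fun T h T' h' e ↦
    hmeq T h T' h' (x T') (by rw [← (show s(v T, x T) = s(v T', x T') from e)]; simp)
      (hxT T' (hLC T' h'))
  have cP₂ : #P₂ = #L := card_image_of_injOn fun T h T' h' e ↦
    hmeq T h T' h' (y T') (by rw [← (show s(v T, y T) = s(v T', y T') from e)]; simp)
      (hyT T' (hLC T' h'))
  have cA : #A = 3 * #I := (hpack.subset hII).card_biUnion_pairsIn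
  have d12 : Disjoint P₁ P₂ := by
    refine disjoint_left.2 fun e h1 h2 ↦ ?_
    obtain ⟨T, h, rfl⟩ := mem_image.1 h1
    obtain ⟨T', h', e⟩ := mem_image.1 h2
    have := hmeq T h T' h' (y T') (by rw [e]; simp) (hyT T' (hLC T' h'))
    subst this
    rw [Sym2.congr_right] at e
    exact hxy T (hLC T h) e.symm
  have dD : ∀ T ∈ L, ∀ e ∈ D, v T ∉ e := by
    intro T h e he hv
    obtain ⟨T', h', rfl⟩ := mem_image.1 he
    have : T = T' := by
      refine hne T (hLC T h) T' (hLC T' h') ?_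
      rcases Sym2.mem_iff.1 hv with e | e <;> rw [e]
      exacts [hxT T' (hLC T' h'), hyT T' (hLC T' h')]
    subst this
    rcases Sym2.mem_iff.1 hv with e | e
    exacts [hvx T (hLC T h) e, hvy T (hLC T h) e]
  have dDP : Disjoint D (P₁ ∪ P₂) := by
    refine disjoint_left.2 fun e h1 h2 ↦ ?_
    rcases mem_union.1 h2 with h2 | h2 <;> obtain ⟨T, h, rfl⟩ := mem_image.1 h2 <;>
      exact dD T h _ h1 (by simp)
  have dA : Disjoint A (D ∪ (P₁ ∪ P₂)) := by
    refine disjoint_left.2 fun e h1 h2 ↦ ?_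
    obtain ⟨T, h, he⟩ := mem_biUnion.1 h1
    have hT' : ∃ T' ∈ L, x T' ∈ e ∨ y T' ∈ e := by
      simp only [mem_union] at h2
      rcases h2 with h2 | h2 | h2 <;> obtain ⟨T', h', rfl⟩ := mem_image.1 h2 <;>
        exact ⟨T', h', by simp⟩
    obtain ⟨T', h', hw | hw⟩ := hT'
    · exact hIL T (hII h) T' h' _ (hxT T' (hLC T' h')) (mem_of_mem_pairsIn he hw)
    · exact hIL T (hII h) T' h' _ (hyT T' (hLC T' h')) (mem_of_mem_pairsIn he hw)
  have hcode : codeEdges I D P = A ∪ (D ∪ (P₁ ∪ P₂)) := by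
    have : (P.biUnion fun q ↦ ({e | ∃ x ∈ q.2, e = s(q.1, x)} : Finset (Sym2 V))) = P₁ ∪ P₂ := by
      ext e
      simp only [hP, hP₁, hP₂, mem_biUnion, mem_image, mem_union, mem_filter, mem_univ, true_and]
      constructor
      · rintro ⟨q, ⟨T, h, rfl⟩, z, hz, rfl⟩
        rcases Sym2.mem_iff.1 hz with rfl | rfl
        exacts [Or.inl ⟨T, h, rfl⟩, Or.inr ⟨T, h, rfl⟩]
      · rintro (⟨T, h, rfl⟩ | ⟨T, h, rfl⟩)
        · exact ⟨_, ⟨T, h, rfl⟩, x T, by simp, rfl⟩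
        · exact ⟨_, ⟨T, h, rfl⟩, y T, by simp, rfl⟩
    rw [codeEdges, this, union_assoc]
  have hpairs : ∀ T ∈ C, s(x T, y T) ∈ pairsIn T ∧ s(v T, x T) ∈ pairsIn T ∧
      s(v T, y T) ∈ pairsIn T := fun T h ↦ by
    simp only [mk_mem_pairsIn]
    exact ⟨⟨hxT T h, hyT T h, hxy T h⟩, ⟨hvT T h, hxT T h, hvx T h⟩, hvT T h, hyT T h, hvy T h⟩
  have hsubC : codeEdges I D P ⊆ C.biUnion pairsIn := by
    rw [hcode]
    refine union_subset (biUnion_subset_biUnion_of_subset_left _ (hII.trans hI₀C)) ?_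
    refine union_subset ?_ (union_subset ?_ ?_) <;> refine image_subset_iff.2 fun T h ↦ ?_ <;>
      refine mem_biUnion.2 ⟨T, hLC T h, ?_⟩
    exacts [(hpairs T (hLC T h)).1, (hpairs T (hLC T h)).2.1, (hpairs T (hLC T h)).2.2]
  have hcov : 6 * m ≤ 6 * #I + 5 * #L := by
    rcases le_total #I₀ m with hle | hle
    · have hII' : #I = #I₀ := by rw [hIc, min_eq_left hle]
      have h1 : triVerts X ⊆ I₀.biUnion id ∪ L.biUnion id := by
        rw [triVerts, ← hCU, ← union_biUnion, filter_union_filter_not_eq]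
      have h2 := (card_le_card h1).trans (card_union_le _ _)
      rw [hpack.card_biUnion] at h2
      have h3 := two_mul_card_biUnion_le (L := L) (fun T h ↦ hC3 T (hLC T h)) (fun T h ↦ by
        have := (mem_filter.1 h).2
        push Not at this
        obtain ⟨T', hT'C, hn, hd⟩ := this
        obtain ⟨w, hw, hw'⟩ := not_disjoint_iff.1 hd
        refine ⟨T', ?_, hn, w, hw, hw'⟩
        by_contra hT'L
        have hT'I : T' ∈ I₀ := by
          simp only [hL, mem_filter, hT'C, true_and, not_not] at hT'L
          exact mem_filter.2 ⟨hT'C, hT'L⟩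
        exact hIL T' hT'I T h w hw hw')
      omega
    · have : #I = m := by rw [hIc, min_eq_right hle]
      omega
  refine ⟨I, D, P, hpack.subset hII, hIc ▸ Nat.min_le_right _ _, ?_, ?_, ?_, ?_, by rwa [cP],
    hsubC.trans (biUnion_subset.2 hCE),
    hsubC.trans (biUnion_subset.2 fun T _ ↦ pairsIn_subset_allPairs T), ?_⟩
  · refine image_subset_iff.2 fun T h ↦ ?_
    exact pairsIn_subset_allPairs T (hpairs T (hLC T h)).1
  · refine image_subset_iff.2 fun T h ↦ ?_
    exact mem_product.2 ⟨mem_univ _, mem_image_of_mem _ h⟩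
  · rw [cP]
    exact card_image_le
  · rw [cP, ← card_image_of_injOn hvinj]
    exact card_le_univ _
  · rw [hcode, card_union_of_disjoint dA, card_union_of_disjoint dDP, card_union_of_disjoint d12,
      cP, cP₁, cP₂, cA]
    omega

end Cover

/-! ### The upper bound for the probability of many triangle vertices -/

section UpperBound
variable {V : Type*} [DecidableEq V] [Fintype V]

/-- The union bound over all codes of triangle covers. -/
lemma bernoulliProb_triVerts_le_sum {p : ℝ} (h0 : 0 ≤ p) (h1 : p ≤ 1) (m : ℕ) :
    bernoulliProb (allPairs V) p {X | 3 * m ≤ #(triVerts X)} ≤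
      ∑ i ∈ range (m + 1), ∑ l ∈ range (Fintype.card V + 1) with 6 * m ≤ 6 * i + 5 * l,
        #(packings V i) * p ^ (3 * i) * ∑ j ∈ range (l + 1),
          ((#(allPairs V)).choose j * p ^ j) *
            ((Fintype.card V * j).choose l * p ^ (2 * l)) := by
  classical
  set E := allPairs V
  set ind : Finset (Σ _ : ℕ, Σ _ : ℕ, ℕ) := (range (m + 1)).sigma fun i ↦
    ((range (Fintype.card V + 1)).filter fun l ↦ 6 * m ≤ 6 * i + 5 * l).sigma fun l ↦
      range (l + 1) with hind
  set codes : (Σ _ : ℕ, Σ _ : ℕ, ℕ) → Finset (Finset (Finset V) × Σ _ : Finset (Sym2 V),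
      Finset (V × Sym2 V)) := fun q ↦ packings V q.1 ×ˢ (powersetCard q.2.2 E).sigma fun D ↦
        powersetCard q.2.1 (univ ×ˢ D) with hcodes
  set good : (Finset (Finset V) × Σ _ : Finset (Sym2 V), Finset (V × Sym2 V)) → Prop :=
    fun c ↦ codeEdges c.1 c.2.1 c.2.2 ⊆ E ∧
      3 * #c.1 + #c.2.1 + 2 * #c.2.2 ≤ #(codeEdges c.1 c.2.1 c.2.2) with hgood
  have hun := mul_bernoulliProb_le_sum (E := E) (p := p) (S := {X | 3 * m ≤ #(triVerts X)})
    (ind.sigma fun q ↦ (codes q).filter good)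
    (fun c ↦ {X | codeEdges c.2.1 c.2.2.1 c.2.2.2 ⊆ X}) 1 h0 h1 ?_
  · rw [Nat.cast_one, one_mul] at hun
    refine hun.trans ?_
    have hterm : ∀ q ∈ ind, ∑ c ∈ (codes q).filter good,
        bernoulliProb E p {X | codeEdges c.1 c.2.1 c.2.2 ⊆ X} ≤
        #(packings V q.1) * p ^ (3 * q.1) * (((#E).choose q.2.2 * p ^ q.2.2) *
            ((Fintype.card V * q.2.2).choose q.2.1 * p ^ (2 * q.2.1))) := by
      rintro ⟨i, l, j⟩ -
      have hle : ∀ c ∈ (codes ⟨i, l, j⟩).filter good,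
          bernoulliProb E p {X | codeEdges c.1 c.2.1 c.2.2 ⊆ X} ≤ p ^ (3 * i + j + 2 * l) := by
        intro c hc
        simp only [hcodes, hgood, mem_filter, mem_product, mem_sigma, mem_packings,
          mem_powersetCard] at hc
        obtain ⟨⟨⟨-, e1⟩, ⟨-, e2⟩, -, e3⟩, hs, hcard⟩ := hc
        rw [bernoulliProb_superset hs]
        rw [e1, e2, e3] at hcard
        exact pow_le_pow_of_le_one h0 h1 hcard
      have hcard : #((codes ⟨i, l, j⟩).filter good) ≤
          #(packings V i) * ((#E).choose j * (Fintype.card V * j).choose l) := by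
        refine (card_filter_le _ _).trans (le_of_eq ?_)
        rw [hcodes, card_product, card_sigma, sum_const_nat (m := (Fintype.card V * j).choose l),
          card_powersetCard]
        intro D hD
        rw [card_powersetCard, card_product, card_univ, (mem_powersetCard.1 hD).2]
      refine (sum_le_card_nsmul _ _ _ hle).trans ?_
      rw [nsmul_eq_mul]
      calc _ ≤ ((#(packings V i) * ((#E).choose j * (Fintype.card V * j).choose l) : ℕ) : ℝ) *
            p ^ (3 * i + j + 2 * l) := by gcongr
        _ = _ := by push_cast; ring
    rw [sum_sigma]
    refine (sum_le_sum hterm).trans (le_of_eq ?_)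
    rw [hind, sum_sigma]
    refine sum_congr rfl fun i _ ↦ ?_
    rw [sum_sigma]
    refine sum_congr rfl fun l _ ↦ ?_
    rw [mul_sum]
  · intro X _ hX
    obtain ⟨I, D, P, hI, hIm, hD, hP, hDP, hPn, hcov, hsub, hE, hcard⟩ := exists_code X m hX
    refine ⟨{⟨⟨#I, #P, #D⟩, (I, ⟨D, P⟩)⟩}, ?_, by simp, ?_⟩
    · rw [singleton_subset_iff]
      simp only [mem_sigma, mem_filter, hind, hcodes, hgood, mem_product, mem_powersetCard,
        mem_packings, mem_range, and_true]
      refine ⟨⟨by omega, ⟨by omega, hcov⟩, by omega⟩, ⟨hI, hD, hP⟩, hE, hcard⟩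
    · intro c hc
      rw [mem_singleton] at hc
      subst hc
      exact hsub

lemma pow_le_inv_pow_mul_exp {x θ : ℝ} (hx : 0 ≤ x) (hθ : 0 < θ) (k : ℕ) :
    x ^ k / k.factorial ≤ θ⁻¹ ^ k * Real.exp (θ * x) := by
  have := Real.pow_div_factorial_le_exp (θ * x) (by positivity) k
  calc x ^ k / k.factorial = θ⁻¹ ^ k * ((θ * x) ^ k / k.factorial) := by
        rw [mul_pow, inv_pow]; field_simp
    _ ≤ _ := by gcongr

lemma choose_mul_pow_le {N j : ℕ} {p y : ℝ} (h0 : 0 ≤ p) (hy : N * p ≤ y) :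
    N.choose j * p ^ j ≤ y ^ j / j.factorial := by
  calc (N.choose j : ℝ) * p ^ j ≤ (N : ℝ) ^ j / j.factorial * p ^ j := by
        gcongr; exact Nat.choose_le_pow_div _ _
    _ = (N * p) ^ j / j.factorial := by rw [mul_pow]; ring
    _ ≤ _ := by gcongr

/-- The contribution of `l` non-isolated triangles to the union bound: `j` is the number of edges
opposite to their private vertices. The factor `exp (θ * b * n)` can be made as small an exponential
as desired, at the expense of the constant in the base of the `l`-th power. -/
lemma sum_choose_mul_choose_le {n N l : ℕ} {p b θ : ℝ} (hn : 0 < n) (h0 : 0 ≤ p) (hb : n * p ≤ b)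
    (hN : N ≤ n ^ 2) (hθ : 0 < θ) (hθ1 : θ ≤ 1) :
    ∑ j ∈ range (l + 1), (N.choose j * p ^ j) * ((n * j).choose l * p ^ (2 * l)) ≤
      Real.exp (θ * b * n) * (Real.exp 1 * b ^ 2 / θ / n) ^ l := by
  have hnR : (0 : ℝ) < n := Nat.cast_pos.2 hn
  have hb0 : 0 ≤ b := le_trans (by positivity) hb
  have hcher : ∀ j ∈ range (l + 1),
      ((n * j).choose l : ℝ) * p ^ (2 * l) ≤ (Real.exp 1 * b ^ 2 / n) ^ l := by
    intro j hj
    have hjl : j ≤ l := Nat.lt_succ_iff.1 (mem_range.1 hj)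
    have h2 : ((n * j : ℕ) : ℝ) * p ^ 2 ≤ l * (b ^ 2 / n) := by
      have : (n * p) ^ 2 ≤ b ^ 2 := by gcongr
      have e : ((n * j : ℕ) : ℝ) * p ^ 2 = j * ((n * p) ^ 2 / n) := by
        push_cast; field_simp
      rw [e]; gcongr
    have h3 := choose_mul_pow_le (j := l) (sq_nonneg p) h2
    rw [← pow_mul] at h3
    refine h3.trans ?_
    have h4 := Real.pow_div_factorial_le_exp (l : ℝ) (Nat.cast_nonneg _) l
    calc (l * (b ^ 2 / n)) ^ l / l.factorial = (l : ℝ) ^ l / l.factorial * (b ^ 2 / n) ^ l := by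
          rw [mul_pow]; ring
      _ ≤ Real.exp l * (b ^ 2 / n) ^ l := by gcongr
      _ = (Real.exp 1 * b ^ 2 / n) ^ l := by
        rw [← Real.exp_one_pow, ← mul_pow]; ring
  have hNp : (N : ℝ) * p ≤ b * n := by
    calc (N : ℝ) * p ≤ (n : ℝ) ^ 2 * p := by gcongr; exact_mod_cast hN
      _ = (n * p) * n := by ring
      _ ≤ b * n := by gcongr
  have hinv : 1 ≤ θ⁻¹ := (one_le_inv₀ hθ).2 hθ1
  calc _ ≤ ∑ j ∈ range (l + 1), ((b * n) ^ j / j.factorial) * (Real.exp 1 * b ^ 2 / n) ^ l := by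
        refine sum_le_sum fun j hj ↦ ?_
        gcongr
        · exact choose_mul_pow_le h0 hNp
        · exact hcher j hj
    _ ≤ ∑ j ∈ range (l + 1), θ⁻¹ ^ l * ((θ * (b * n)) ^ j / j.factorial) *
          (Real.exp 1 * b ^ 2 / n) ^ l := by
        refine sum_le_sum fun j hj ↦ ?_
        gcongr
        have hjl : j ≤ l := Nat.lt_succ_iff.1 (mem_range.1 hj)
        calc (b * n) ^ j / j.factorial = θ⁻¹ ^ j * ((θ * (b * n)) ^ j / j.factorial) := by
              rw [mul_pow θ, inv_pow]; field_simp
          _ ≤ _ := by gcongr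
    _ = θ⁻¹ ^ l * (∑ j ∈ range (l + 1), (θ * (b * n)) ^ j / j.factorial) *
          (Real.exp 1 * b ^ 2 / n) ^ l := by rw [← sum_mul, ← mul_sum]
    _ ≤ θ⁻¹ ^ l * Real.exp (θ * (b * n)) * (Real.exp 1 * b ^ 2 / n) ^ l := by
        gcongr
        exact Real.sum_le_exp_of_nonneg (by positivity) _
    _ = _ := by
        rw [mul_right_comm, ← mul_pow, mul_comm, mul_assoc θ]
        congr 2
        field_simp

/-- The first moment of the number of packings by `i ≤ m` triangles, compared with that for `m`. -/
lemma card_packings_mul_pow_le_of_add_eq {i d m : ℕ} {p a θ : ℝ} (him : i + d = m)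
    (hm : 3 * m ≤ Fintype.card V) (ha : 0 < a) (hp : a ≤ Fintype.card V * p) (h0 : 0 < p)
    (hθ : 0 < θ) :
    #(packings V i) * p ^ (3 * i) ≤ #(packings V m) * p ^ (3 * m) *
      (Real.exp (θ * Fintype.card V) * (6 / (a * θ) ^ 3 * Fintype.card V) ^ d) := by
  set n := Fintype.card V
  have h1 : (#(packings V i) : ℝ) * (3 * d).factorial ≤ #(packings V m) * (6 * n) ^ d := by
    have := card_packings_mul_factorial_le d i m him hm
    calc (#(packings V i) : ℝ) * (3 * d).factorial ≤ #(packings V m) * (6 * m) ^ d := by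
          exact_mod_cast this
      _ ≤ _ := by gcongr; omega
  have h2 := pow_le_inv_pow_mul_exp (x := n) (Nat.cast_nonneg _) hθ (3 * d)
  have hf : (0 : ℝ) < (3 * d).factorial := by positivity
  rw [div_le_iff₀ hf] at h2
  have h3 : a ^ (3 * d) ≤ n ^ (3 * d) * p ^ (3 * d) := by
    rw [← mul_pow]; gcongr
  have key : (#(packings V i) : ℝ) ≤ #(packings V m) * p ^ (3 * d) *
      (Real.exp (θ * n) * (6 / (a * θ) ^ 3 * n) ^ d) := by
    have haF : 0 < a ^ (3 * d) * (3 * d).factorial := by positivity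
    rw [← mul_le_mul_iff_left₀ haF]
    calc #(packings V i) * (a ^ (3 * d) * (3 * d).factorial)
        = (#(packings V i) * (3 * d).factorial) * a ^ (3 * d) := by ring
      _ ≤ (#(packings V m) * (6 * n) ^ d) * (n ^ (3 * d) * p ^ (3 * d)) := by gcongr
      _ = (#(packings V m) * (6 * n) ^ d) * p ^ (3 * d) * n ^ (3 * d) := by ring
      _ ≤ (#(packings V m) * (6 * n) ^ d) * p ^ (3 * d) *
          (θ⁻¹ ^ (3 * d) * Real.exp (θ * n) * (3 * d).factorial) := by gcongr
      _ = _ := by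
        simp only [pow_mul, mul_pow, div_pow, inv_pow]
        field_simp
  calc (#(packings V i) : ℝ) * p ^ (3 * i) ≤ #(packings V m) * p ^ (3 * d) *
      (Real.exp (θ * n) * (6 / (a * θ) ^ 3 * n) ^ d) * p ^ (3 * i) := by gcongr
    _ = _ := by rw [← him, mul_add, pow_add]; ring

/-- The saving `n ^ (-l)` from non-isolated triangles beats the loss `n ^ d` from having `d` isolated
triangles fewer. -/
lemma mul_pow_mul_div_pow_le_one {c₁ c₂ n : ℝ} {d l : ℕ} (h1 : 1 ≤ c₁) (h2 : 1 ≤ c₂)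
    (hn : (c₁ * c₂) ^ 6 ≤ n) (hdl : 6 * d ≤ 5 * l) : (c₁ * n) ^ d * (c₂ / n) ^ l ≤ 1 := by
  have hc : 1 ≤ c₁ * c₂ := one_le_mul_of_one_le_of_one_le h1 h2
  have hn0 : 0 < n := lt_of_lt_of_le (by positivity) hn
  obtain ⟨k, rfl⟩ := Nat.exists_eq_add_of_le (show d ≤ l by omega)
  have e : (c₁ * n) ^ d * (c₂ / n) ^ (d + k) = (c₁ ^ d * c₂ ^ (d + k)) / n ^ k := by
    rw [div_pow, mul_pow, pow_add n]; field_simp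
  rw [e, div_le_one (by positivity)]
  calc c₁ ^ d * c₂ ^ (d + k) ≤ c₁ ^ (d + k) * c₂ ^ (d + k) := by
        gcongr
        · omega
    _ = (c₁ * c₂) ^ (d + k) := by rw [mul_pow]
    -- `d + k = l ≤ 6 * (l - d) = 6 * k`
    _ ≤ (c₁ * c₂) ^ (6 * k) := pow_le_pow_right₀ hc (by omega)
    _ = ((c₁ * c₂) ^ 6) ^ k := by rw [pow_mul]
    _ ≤ n ^ k := by gcongr

/-- One summand of the union bound over codes, compared with the first moment of the number of
packings. -/
lemma code_term_le {p a b θ c₁ c₂ : ℝ} (h0 : 0 < p) (ha : 0 < a)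
    (hpa : a ≤ Fintype.card V * p) (hpb : Fintype.card V * p ≤ b) (hθ : 0 < θ) (hθ1 : θ ≤ 1)
    (hc₁ : 1 ≤ c₁) (hc₁' : 6 / (a * θ) ^ 3 ≤ c₁) (hc₂ : 1 ≤ c₂)
    (hc₂' : Real.exp 1 * b ^ 2 / θ ≤ c₂) (hn : (c₁ * c₂) ^ 6 ≤ Fintype.card V)
    {i d l m : ℕ} (him : i + d = m) (hm : 3 * m ≤ Fintype.card V) (hdl : 6 * d ≤ 5 * l) :
    #(packings V i) * p ^ (3 * i) * ∑ j ∈ range (l + 1), ((#(allPairs V)).choose j * p ^ j) *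
        ((Fintype.card V * j).choose l * p ^ (2 * l)) ≤
      Real.exp (θ * (1 + b) * Fintype.card V) * (#(packings V m) * p ^ (3 * m)) := by
  have A := card_packings_mul_pow_le_of_add_eq him hm ha hpa h0 hθ
  have hnR : (0 : ℝ) < Fintype.card V := lt_of_lt_of_le (by positivity) hn
  have hN : #(allPairs V) ≤ Fintype.card V ^ 2 := by
    rw [card_allPairs]; exact Nat.choose_le_pow _ _
  have B := sum_choose_mul_choose_le (l := l) (Nat.cast_pos.1 hnR) h0.le hpb hN hθ hθ1
  have C := mul_pow_mul_div_pow_le_one hc₁ hc₂ hn hdl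
  have hB0 : 0 ≤ ∑ j ∈ range (l + 1), ((#(allPairs V)).choose j * p ^ j) *
      (((Fintype.card V * j).choose l : ℝ) * p ^ (2 * l)) := by positivity
  have hM : 0 ≤ (#(packings V m) : ℝ) * p ^ (3 * m) := by positivity
  have h3 : 0 ≤ 6 / (a * θ) ^ 3 := by positivity
  have h4 : 0 ≤ Real.exp 1 * b ^ 2 / θ := by positivity
  generalize (Fintype.card V : ℝ) = n at *
  generalize (#(packings V m) : ℝ) * p ^ (3 * m) = M at *
  generalize 6 / (a * θ) ^ 3 = k₁ at *
  generalize Real.exp 1 * b ^ 2 / θ = k₂ at *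
  calc _ ≤ (M * (Real.exp (θ * n) * (k₁ * n) ^ d)) * (Real.exp (θ * b * n) * (k₂ / n) ^ l) :=
        mul_le_mul A B hB0 (by positivity)
    _ ≤ (M * (Real.exp (θ * n) * (c₁ * n) ^ d)) * (Real.exp (θ * b * n) * (c₂ / n) ^ l) := by
      gcongr
    _ = Real.exp (θ * n) * Real.exp (θ * b * n) * M * ((c₁ * n) ^ d * (c₂ / n) ^ l) := by ring
    _ ≤ Real.exp (θ * n) * Real.exp (θ * b * n) * M * 1 := by gcongr
    _ = _ := by rw [← Real.exp_add]; ring_nf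

/-- The first moment of the number of packings of `m` triangles is, up to a subexponential factor,
an upper bound for the probability that at least `3 * m` vertices lie in triangles. -/
lemma bernoulliProb_triVerts_le_exp_mul {p a b θ c₁ c₂ : ℝ} (h0 : 0 < p) (h1 : p ≤ 1) (ha : 0 < a)
    (hpa : a ≤ Fintype.card V * p) (hpb : Fintype.card V * p ≤ b) (hθ : 0 < θ) (hθ1 : θ ≤ 1)
    (hc₁ : 1 ≤ c₁) (hc₁' : 6 / (a * θ) ^ 3 ≤ c₁) (hc₂ : 1 ≤ c₂)
    (hc₂' : Real.exp 1 * b ^ 2 / θ ≤ c₂) (hn : (c₁ * c₂) ^ 6 ≤ Fintype.card V)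
    {m : ℕ} (hm : 3 * m ≤ Fintype.card V) :
    bernoulliProb (allPairs V) p {X | 3 * m ≤ #(triVerts X)} ≤
      (Fintype.card V + 1) ^ 2 * Real.exp (θ * (1 + b) * Fintype.card V) *
        (#(packings V m) * p ^ (3 * m)) := by
  refine (bernoulliProb_triVerts_le_sum h0.le h1 m).trans ?_
  have hR : 0 ≤ Real.exp (θ * (1 + b) * Fintype.card V) * (#(packings V m) * p ^ (3 * m)) := by
    positivity
  calc _ ≤ ∑ i ∈ range (m + 1), ∑ l ∈ range (Fintype.card V + 1) with 6 * m ≤ 6 * i + 5 * l,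
        Real.exp (θ * (1 + b) * Fintype.card V) * (#(packings V m) * p ^ (3 * m)) := by
        refine sum_le_sum fun i hi ↦ sum_le_sum fun l hl ↦ ?_
        obtain ⟨d, hd⟩ := Nat.exists_eq_add_of_le (Nat.lt_succ_iff.1 (mem_range.1 hi))
        have hl' := (mem_filter.1 hl).2
        exact code_term_le h0 ha hpa hpb hθ hθ1 hc₁ hc₁' hc₂ hc₂' hn hd.symm hm (by omega)
    _ ≤ ∑ i ∈ range (m + 1), ∑ l ∈ range (Fintype.card V + 1),
        Real.exp (θ * (1 + b) * Fintype.card V) * (#(packings V m) * p ^ (3 * m)) :=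
      sum_le_sum fun i _ ↦ sum_le_sum_of_subset_of_nonneg (filter_subset _ _) fun _ _ _ ↦ hR
    _ = (m + 1) * (Fintype.card V + 1) *
        (Real.exp (θ * (1 + b) * Fintype.card V) * (#(packings V m) * p ^ (3 * m))) := by
      simp only [sum_const, card_range, nsmul_eq_mul]; push_cast; ring
    _ ≤ (Fintype.card V + 1) * (Fintype.card V + 1) *
        (Real.exp (θ * (1 + b) * Fintype.card V) * (#(packings V m) * p ^ (3 * m))) := by
      gcongr; omega
    _ = _ := by ring

end UpperBound

/-! ### The moment generating function of the number of edges -/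

section Tilting

lemma eventually_mul_pow_le_exp (C c : ℝ) {δ : ℝ} (k : ℕ) (hδ : 0 < δ) :
    ∀ᶠ n : ℕ in Filter.atTop, C * ((n : ℝ) + c) ^ k ≤ Real.exp (δ * n) := by
  have h1 : Filter.Tendsto (fun n : ℕ ↦ δ * ((n : ℝ) + c)) Filter.atTop Filter.atTop :=
    (Filter.tendsto_atTop_add_const_right _ c tendsto_natCast_atTop_atTop).const_mul_atTop hδ
  have h2 := ((Real.tendsto_pow_mul_exp_neg_atTop_nhds_zero k).comp h1).const_mul
    (C * Real.exp (δ * c) / δ ^ k)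
  rw [mul_zero] at h2
  filter_upwards [h2.eventually (gt_mem_nhds zero_lt_one)] with n hn
  simp only [Function.comp] at hn
  rw [mul_pow, Real.exp_neg, mul_add, Real.exp_add] at hn
  have e : C * Real.exp (δ * c) / δ ^ k * (δ ^ k * ((n : ℝ) + c) ^ k *
      (Real.exp (δ * n) * Real.exp (δ * c))⁻¹) = C * ((n : ℝ) + c) ^ k / Real.exp (δ * n) := by
    field_simp
  rw [e, div_lt_one (Real.exp_pos _)] at hn
  exact hn.le

variable {V : Type*} [DecidableEq V] [Fintype V]

/-- The moment generating function of the number of edges on the event that at least `t` vertices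
lie in triangles. Tilting the edge weights by `x` amounts to changing the edge probability, and
the first moment of the number of packings, which governs the probability of the event for either
edge probability, changes by an explicit power of `x`. -/
lemma bernoulliGenFun_triVerts_le {lam p x θ c₁ c₂ : ℝ} {m t K : ℕ} (hlam : 0 < lam) (h0 : 0 < p)
    (h1 : p ≤ 1) (hp : Fintype.card V * p = lam) (hx : 0 < x) (hθ : 0 < θ) (hθ1 : θ ≤ 1)
    (hc₁ : 1 ≤ c₁) (hc₁' : 6 / (lam * x / (1 + x) * θ) ^ 3 ≤ c₁) (hc₂ : 1 ≤ c₂)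
    (hc₂' : Real.exp 1 * (lam * (1 + x)) ^ 2 / θ ≤ c₂) (hn : (c₁ * c₂) ^ 6 ≤ Fintype.card V)
    (hK0 : 0 < K) (hK : 2 * (lam ^ 3 + lam ^ 2) ≤ K) (hmt : 3 * m ≤ t) (htm : t ≤ 3 * m + 3)
    (ht : t ≤ Fintype.card V) (h3 : 3 ≤ Fintype.card V) :
    bernoulliGenFun (allPairs V) p x {X | t ≤ #(triVerts X)} ≤
    ((1 - p + p * x) ^ (#(allPairs V) - 3 * m) * x ^ (3 * m)) *
      Real.exp (θ * (1 + lam * (1 + x)) * Fintype.card V) *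
      (16 / lam ^ 3 * (Fintype.card V + (K + 1)) ^ (K + 8)) *
      bernoulliProb (allPairs V) p {X | t ≤ #(triVerts X)} := by
  have hz : 0 < 1 - p + p * x := by nlinarith [mul_pos h0 hx]
  rw [bernoulliGenFun_eq hz.ne']
  set n := Fintype.card V with hndef
  set N := #(allPairs V) with hN
  set z := 1 - p + p * x with hzdef
  -- these two place the tilted edge probability `p * x / z` between multiples of `1 / n`
  have hz2 : z ≤ 1 + x := by nlinarith
  have hz3 : x ≤ (1 + x) * z := by nlinarith [mul_nonneg h0.le (sq_nonneg x)]
  have hnp : (n : ℝ) * (p * x / z) = lam * x / z := by rw [← hp]; ring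
  have hnN : 3 * m ≤ N := by
    have : n ≤ N := by
      rw [hN, card_allPairs, Nat.choose_two_right, Nat.le_div_iff_mul_le two_pos]
      exact Nat.mul_le_mul_left _ (by omega)
    omega
  have hU := bernoulliProb_triVerts_le_exp_mul (V := V) (p := p * x / z) (a := lam * x / (1 + x))
    (b := lam * (1 + x)) (m := m) (by positivity) (by rw [div_le_one hz]; linarith) (by positivity)
    (by rw [hnp]; gcongr) (by rw [hnp, div_le_iff₀ hz, mul_assoc]; gcongr) hθ hθ1 hc₁ hc₁' hc₂
    hc₂' hn (by omega)
  have hmono : bernoulliProb (allPairs V) (p * x / z) {X | t ≤ #(triVerts X)} ≤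
      bernoulliProb (allPairs V) (p * x / z) {X | 3 * m ≤ #(triVerts X)} :=
    bernoulliProb_mono (by positivity) (by rw [div_le_one hz]; linarith)
      fun X _ hX ↦ hmt.trans hX
  have hL := card_packings_mul_pow_le (V := V) h0.le h1 hp.le m K hK0 hK
  have hS := bernoulliProb_triVerts_le (V := V) h0 h1 htm ht h3
  have hP : 0 ≤ bernoulliProb (allPairs V) p {X | t ≤ #(triVerts X)} :=
    bernoulliProb_nonneg h0.le h1
  have hmn : (m : ℝ) ≤ n := by exact_mod_cast (show m ≤ n by omega)
  generalize bernoulliProb (allPairs V) (p * x / z) {X | t ≤ #(triVerts X)} = Q₁ at *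
  generalize bernoulliProb (allPairs V) (p * x / z) {X | 3 * m ≤ #(triVerts X)} = Q₂ at *
  generalize bernoulliProb (allPairs V) p {X | 3 * m ≤ #(triVerts X)} = Q₃ at *
  generalize bernoulliProb (allPairs V) p {X | t ≤ #(triVerts X)} = Q₄ at *
  generalize (#(packings V m) : ℝ) = D at *
  rw [← hndef] at hU hS
  clear_value n N z
  have hn1 : (1 : ℝ) ≤ n := by exact_mod_cast (show 1 ≤ n by omega)
  have hQ₃ : Q₃ ≤ 8 * n ^ 6 / lam ^ 3 * Q₄ := by
    have : p = lam / n := by rw [← hp]; field_simp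
    rw [this, div_pow, div_mul_eq_mul_div, div_le_iff₀ (by positivity)] at hS
    rw [div_mul_eq_mul_div, le_div_iff₀ (by positivity)]
    linarith
  have hpoly : ((n : ℝ) + 1) ^ 2 * (2 * (m + K) ^ K * (8 * n ^ 6 / lam ^ 3 * Q₄)) ≤
      (16 / lam ^ 3 * (n + (K + 1)) ^ (K + 8)) * Q₄ := by
    have hKR : (0 : ℝ) ≤ K := Nat.cast_nonneg _
    calc _ ≤ ((n : ℝ) + (K + 1)) ^ 2 *
          (2 * (n + (K + 1)) ^ K * (8 * (n + (K + 1)) ^ 6 / lam ^ 3 * Q₄)) := by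
          gcongr <;> linarith
      _ = _ := by rw [pow_add]; ring
  push_cast at hL
  set e := Real.exp (θ * (1 + lam * (1 + x)) * n)
  have he : 0 ≤ e := (Real.exp_pos _).le
  calc z ^ N * Q₁ ≤ z ^ N * ((n + 1) ^ 2 * e * (D * (p * x / z) ^ (3 * m))) := by
        gcongr; exact hmono.trans hU
    _ = (z ^ (N - 3 * m) * x ^ (3 * m)) * e * ((n + 1) ^ 2 * (D * p ^ (3 * m))) := by
        rw [← Nat.sub_add_cancel hnN, Nat.add_sub_cancel, pow_add, div_pow, mul_pow]
        field_simp
    _ ≤ (z ^ (N - 3 * m) * x ^ (3 * m)) * e *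
          ((n + 1) ^ 2 * (2 * (m + K) ^ K * (8 * n ^ 6 / lam ^ 3 * Q₄))) := by
        have hL' := hL.trans (mul_le_mul_of_nonneg_left hQ₃ (by positivity))
        exact mul_le_mul_of_nonneg_left (mul_le_mul_of_nonneg_left hL' (by positivity))
          (by positivity)
    _ ≤ (z ^ (N - 3 * m) * x ^ (3 * m)) * e *
          ((16 / lam ^ 3 * (n + (K + 1)) ^ (K + 8)) * Q₄) := by gcongr
    _ = _ := by ring

/-- With `p = lam / n`, the factor `(1 - p + p * x) ^ (N - 3 * m)` is `exp (n * lam * (x - 1) / 2)` up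
to a constant. -/
lemma one_sub_add_pow_le {lam x : ℝ} {n m : ℕ} (hlam : 0 < lam) (hx : 0 < x) (hn : 0 < n)
    (hnlam : lam ≤ n) (hmn : 3 * m ≤ n) (hm : 3 * m ≤ n.choose 2) :
    (1 - lam / n + lam / n * x) ^ (n.choose 2 - 3 * m) ≤
      Real.exp (n * (lam * (x - 1) / 2) + 2 * lam * |x - 1|) := by
  have hn0 : (0 : ℝ) < n := Nat.cast_pos.2 hn
  have h1 : lam / n ≤ 1 := by rw [div_le_one hn0]; exact hnlam
  have h2 : 0 < lam / n * x := by positivity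
  calc (1 - lam / n + lam / n * x) ^ (n.choose 2 - 3 * m)
      ≤ Real.exp (lam / n * (x - 1)) ^ (n.choose 2 - 3 * m) := by
        refine pow_le_pow_left₀ (by linarith) ?_ _
        rw [show 1 - lam / n + lam / n * x = lam / n * (x - 1) + 1 by ring]
        exact Real.add_one_le_exp _
    _ = Real.exp ((n.choose 2 - 3 * m) * (lam / n * (x - 1))) := by
        rw [← Real.exp_nat_mul, Nat.cast_sub hm]
        push_cast
        ring_nf
    _ ≤ _ := by
      rw [Real.exp_le_exp]
      have e1 : (n.choose 2 - 3 * m) * (lam / n * (x - 1)) =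
          n * (lam * (x - 1) / 2) - (lam / 2 + 3 * m * lam / n) * (x - 1) := by
        rw [Nat.cast_choose_two]; field_simp; ring
      have e2 : 3 * m * lam / n ≤ lam := by
        have : (3 : ℝ) * m ≤ n := by exact_mod_cast hmn
        rw [div_le_iff₀ hn0]
        nlinarith
      have e3 : 0 ≤ 3 * m * lam / n := by positivity
      have e4 : |(lam / 2 + 3 * m * lam / n) * (x - 1)| ≤ 2 * lam * |x - 1| := by
        rw [abs_mul, abs_of_nonneg (by positivity)]
        gcongr; linarith
      linarith [neg_abs_le ((lam / 2 + 3 * m * lam / n) * (x - 1))]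

/-- Asymptotic form of the bound on the moment generating function of the number of edges. -/
lemma eventually_bernoulliGenFun_triVerts_le {lam a : ℝ} (hlam : 0 < lam) (ha0 : 0 < a)
    (ha1 : a ≤ 1) (y : ℝ) {η : ℝ} (hη : 0 < η) : ∀ᶠ n : ℕ in Filter.atTop,
    bernoulliGenFun (allPairs (Fin n)) (lam / n) (Real.exp y) {X | a * n ≤ #(triVerts X)} ≤
    Real.exp (n * (lam * (Real.exp y - 1) / 2 + a * y + η)) *
      bernoulliProb (allPairs (Fin n)) (lam / n) {X | a * n ≤ #(triVerts X)} := by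
  set x := Real.exp y with hxdef
  have hx : 0 < x := Real.exp_pos y
  set b := lam * (1 + x) with hb
  have hb0 : 0 < b := by positivity
  -- half of the rate `η` absorbs the factor `exp (θ * (1 + b) * n)`, half the polynomial factors
  set θ := min 1 (η / (2 * (1 + b))) with hθdef
  have hθ : 0 < θ := lt_min one_pos (by positivity)
  have hθ1 : θ ≤ 1 := min_le_left _ _
  have hθ2 : θ * (1 + b) ≤ η / 2 := by
    calc θ * (1 + b) ≤ η / (2 * (1 + b)) * (1 + b) := by
          gcongr; exact min_le_right _ _
      _ = η / 2 := by field_simp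
  obtain ⟨c₁, hc₁, hc₁'⟩ : ∃ c : ℝ, 1 ≤ c ∧ 6 / (lam * x / (1 + x) * θ) ^ 3 ≤ c :=
    ⟨_, le_max_left _ _, le_max_right _ _⟩
  obtain ⟨c₂, hc₂, hc₂'⟩ : ∃ c : ℝ, 1 ≤ c ∧ Real.exp 1 * b ^ 2 / θ ≤ c :=
    ⟨_, le_max_left _ _, le_max_right _ _⟩
  obtain ⟨K, hK⟩ := exists_nat_ge (2 * (lam ^ 3 + lam ^ 2))
  have hK0 : 0 < K := by
    have : (0 : ℝ) < K := lt_of_lt_of_le (by positivity) hK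
    exact_mod_cast this
  have hgrow := eventually_mul_pow_le_exp
    (16 / lam ^ 3 * Real.exp (2 * lam * |x - 1| + 3 * |y|)) (K + 1) (δ := η / 2) (K + 8)
    (by positivity)
  have hlarge := (tendsto_natCast_atTop_atTop (R := ℝ)).eventually_ge_atTop ((c₁ * c₂) ^ 6)
  have hlarge' := (tendsto_natCast_atTop_atTop (R := ℝ)).eventually_ge_atTop lam
  filter_upwards [hgrow, hlarge, hlarge', Filter.eventually_ge_atTop 3] with n hgrow hn hnlam h3
  have hn0 : (0 : ℝ) < n := by exact_mod_cast (show 0 < n by omega)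
  set t := ⌈a * n⌉₊ with ht
  set m := ⌊a * n / 3⌋₊ with hm
  have han : 0 ≤ a * n := by positivity
  have hm1 : (m : ℝ) ≤ a * n / 3 := Nat.floor_le (by positivity)
  have hm2 : a * n / 3 < m + 1 := Nat.lt_floor_add_one _
  have hmt : 3 * m ≤ t := by
    have : ((3 * m : ℕ) : ℝ) ≤ t := by push_cast; linarith [Nat.le_ceil (a * n)]
    exact_mod_cast this
  have htm : t ≤ 3 * m + 3 := Nat.ceil_le.2 (by push_cast; linarith)
  have htn : t ≤ n := Nat.ceil_le.2 (by nlinarith)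
  have hset : ({X : Finset (Sym2 (Fin n)) | a * n ≤ #(triVerts X)} : Set _) =
      {X | t ≤ #(triVerts X)} := by
    ext X; simp [ht, Nat.ceil_le]
  rw [hset]
  have h0 : 0 < lam / n := by positivity
  have h1 : lam / n ≤ 1 := by rw [div_le_one hn0]; exact hnlam
  refine (bernoulliGenFun_triVerts_le (V := Fin n) hlam h0 h1 (by rw [Fintype.card_fin]; field_simp) hx
    hθ hθ1 hc₁ hc₁' hc₂ hc₂' (by simpa using hn) hK0 hK hmt htm (by simpa using htn)
    (by simpa using h3)).trans ?_
  rw [card_allPairs, Fintype.card_fin]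
  have hP : 0 ≤ bernoulliProb (allPairs (Fin n)) (lam / n) {X | t ≤ #(triVerts X)} :=
    bernoulliProb_nonneg h0.le h1
  refine mul_le_mul_of_nonneg_right ?_ hP
  have hN3 : 3 * m ≤ n.choose 2 := by
    rw [Nat.choose_two_right, Nat.le_div_iff_mul_le two_pos]
    have : n * 2 ≤ n * (n - 1) := Nat.mul_le_mul_left _ (by omega)
    omega
  have hz := one_sub_add_pow_le hlam hx (by omega) hnlam (by omega) hN3
  have hx3 : x ^ (3 * m) ≤ Real.exp (n * (a * y) + 3 * |y|) := by
    rw [hxdef, ← Real.exp_nat_mul, Real.exp_le_exp]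
    push_cast
    have e1 : |(3 * m - a * n) * y| ≤ 3 * |y| := by
      rw [abs_mul]
      gcongr
      rw [abs_le]; constructor <;> linarith
    have := le_abs_self ((3 * m - a * n) * y)
    linarith
  have hθe : Real.exp (θ * (1 + b) * n) ≤ Real.exp (η / 2 * n) := by gcongr
  have hz0 : 0 ≤ 1 - lam / n + lam / n * x := by nlinarith [mul_pos h0 hx]
  rw [hb] at hθe
  clear_value x θ b t m
  calc _ ≤ (Real.exp (n * (lam * (x - 1) / 2) + 2 * lam * |x - 1|) *
        Real.exp (n * (a * y) + 3 * |y|)) * Real.exp (η / 2 * n) *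
        (16 / lam ^ 3 * (n + (K + 1)) ^ (K + 8)) := by
        refine mul_le_mul_of_nonneg_right (mul_le_mul (mul_le_mul hz hx3 ?_ ?_) hθe ?_ ?_) ?_ <;>
          positivity
    _ = Real.exp (n * (lam * (x - 1) / 2) + n * (a * y) + η / 2 * n) *
        (16 / lam ^ 3 * Real.exp (2 * lam * |x - 1| + 3 * |y|) * (n + (K + 1)) ^ (K + 8)) := by
        simp only [Real.exp_add]; ring
    _ ≤ Real.exp (n * (lam * (x - 1) / 2) + n * (a * y) + η / 2 * n) *
        Real.exp (η / 2 * n) := mul_le_mul_of_nonneg_left hgrow (Real.exp_pos _).le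
    _ = _ := by rw [← Real.exp_add]; ring_nf

end Tilting

/-! ### Concentration of the number of edges -/

section Concentration

/-- The complete graph witnesses that the event of many triangle vertices has positive probability. -/
lemma card_allPairs_pow_le_bernoulliProb {V : Type*} [DecidableEq V] [Fintype V] {p : ℝ}
    (h0 : 0 ≤ p) (h1 : p ≤ 1) (h3 : 3 ≤ Fintype.card V) {t : ℕ} (ht : t ≤ Fintype.card V) :
    p ^ #(allPairs V) ≤ bernoulliProb (allPairs V) p {X | t ≤ #(triVerts X)} := by
  rw [← bernoulliProb_superset (E := allPairs V) (p := p) subset_rfl]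
  refine bernoulliProb_mono h0 h1 fun X _ hX ↦ ?_
  have : triVerts X = univ := by
    refine eq_univ_of_forall fun v ↦ ?_
    obtain ⟨W, hvW, -, hW⟩ := exists_subsuperset_card_eq (n := 3) (subset_univ {v}) (by simp)
      (by rwa [card_univ])
    exact mem_triVerts.2 ⟨W, mem_trianglesOf.2 ⟨hW, (pairsIn_subset_allPairs W).trans hX⟩,
      hvW (mem_singleton_self v)⟩
  rwa [Set.mem_ofPred_eq, this, card_univ]

/-- Chernoff's bound for one tail of the number of edges, on the event that at least `a * n`
vertices lie in triangles. The sign of `y` selects the tail. -/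
lemma eventually_bernoulliProb_tail_le {lam a ε y : ℝ} (hlam : 0 < lam) (ha0 : 0 < a) (ha1 : a ≤ 1)
    (hε : 0 < ε) (hy0 : y ≠ 0) (hy1 : |y| ≤ 1) (hy : lam * |y| ≤ ε) :
    ∀ᶠ n : ℕ in Filter.atTop,
      bernoulliProb (allPairs (Fin n)) (lam / n) {X | a * n ≤ #(triVerts X) ∧
        |y| * ε * n ≤ y * (#X - (a + lam / 2) * n)} ≤
      Real.exp (-(|y| * ε / 4) * n) *
        bernoulliProb (allPairs (Fin n)) (lam / n) {X | a * n ≤ #(triVerts X)} := by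
  have hyp : 0 < |y| := abs_pos.2 hy0
  have hη : 0 < |y| * ε / 4 := by positivity
  have hlarge := (tendsto_natCast_atTop_atTop (R := ℝ)).eventually_ge_atTop lam
  filter_upwards [eventually_bernoulliGenFun_triVerts_le hlam ha0 ha1 y hη, hlarge,
    Filter.eventually_gt_atTop 0] with n hn hnlam hn0
  have hnR : (0 : ℝ) < n := Nat.cast_pos.2 hn0
  have h0 : 0 ≤ lam / n := by positivity
  have h1 : lam / n ≤ 1 := by rw [div_le_one hnR]; exact hnlam
  have hmark := mul_bernoulliProb_le_bernoulliGenFun (E := allPairs (Fin n)) (p := lam / n)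
    (S := {X | a * n ≤ #(triVerts X) ∧ |y| * ε * n ≤ y * (#X - (a + lam / 2) * n)})
    (T := {X | a * n ≤ #(triVerts X)}) (x := Real.exp y)
    (c := Real.exp (n * (y * (a + lam / 2) + |y| * ε))) (Real.exp_pos y).le h0 h1
    (fun X hX ↦ hX.1) (fun X hX ↦ by
      rw [← Real.exp_nat_mul, Real.exp_le_exp]
      linarith [hX.2])
  have hP : 0 ≤ bernoulliProb (allPairs (Fin n)) (lam / n) {X | a * n ≤ #(triVerts X)} :=
    bernoulliProb_nonneg h0 h1
  -- `exp y - 1 - y ≤ y ^ 2` and `lam * y ^ 2 ≤ |y| * ε`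
  have hrate : lam * (Real.exp y - 1) / 2 + a * y + |y| * ε / 4 ≤
      (y * (a + lam / 2) + |y| * ε) - |y| * ε / 4 := by
    have h2 := le_of_abs_le (Real.abs_exp_sub_one_sub_id_le hy1)
    have h3 : lam * y ^ 2 ≤ |y| * ε := by
      rw [← sq_abs]; nlinarith
    nlinarith
  rw [← mul_le_mul_iff_right₀ (Real.exp_pos (n * (y * (a + lam / 2) + |y| * ε)))]
  refine hmark.trans (hn.trans ?_)
  rw [← mul_assoc, ← Real.exp_add]
  refine mul_le_mul_of_nonneg_right (Real.exp_le_exp.2 ?_) hP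
  have := mul_le_mul_of_nonneg_left hrate hnR.le
  linarith

/-- Given that at least `a * n` vertices lie in triangles, the number of edges is exponentially
unlikely to differ from `(a + lam / 2) * n` by `ε * n`. -/
lemma eventually_bernoulliProb_deviation_le {lam a ε : ℝ} (hlam : 0 < lam) (ha0 : 0 < a)
    (ha1 : a ≤ 1) (hε : 0 < ε) : ∃ c > 0, ∀ᶠ n : ℕ in Filter.atTop,
      bernoulliProb (allPairs (Fin n)) (lam / n) {X | a * n ≤ #(triVerts X) ∧
        ε ≤ |(#X : ℝ) / n - (a + lam / 2)|} ≤
      2 * Real.exp (-c * n) *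
        bernoulliProb (allPairs (Fin n)) (lam / n) {X | a * n ≤ #(triVerts X)} := by
  set y := min 1 (ε / lam) with hydef
  have hy0 : 0 < y := lt_min one_pos (by positivity)
  have hy1 : y ≤ 1 := min_le_left _ _
  have hy : lam * y ≤ ε := by
    rw [← le_div_iff₀' hlam]; exact min_le_right _ _
  have habs : |y| = y := abs_of_pos hy0
  refine ⟨y * ε / 4, by positivity, ?_⟩
  have hlarge := (tendsto_natCast_atTop_atTop (R := ℝ)).eventually_ge_atTop lam
  filter_upwards [eventually_bernoulliProb_tail_le (y := y) hlam ha0 ha1 hε hy0.ne'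
      (by rwa [habs]) (by rwa [habs]),
    eventually_bernoulliProb_tail_le (y := -y) hlam ha0 ha1 hε (neg_ne_zero.2 hy0.ne')
      (by rwa [abs_neg, habs]) (by rwa [abs_neg, habs]), hlarge,
    Filter.eventually_gt_atTop 0] with n hup hlow hnlam hn0
  have hnR : (0 : ℝ) < n := Nat.cast_pos.2 hn0
  have h0 : 0 ≤ lam / n := by positivity
  have h1 : lam / n ≤ 1 := by rw [div_le_one hnR]; exact hnlam
  rw [habs] at hup
  rw [abs_neg, habs] at hlow
  have hun := mul_bernoulliProb_le_sum (E := allPairs (Fin n)) (p := lam / n)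
    (S := {X | a * n ≤ #(triVerts X) ∧ ε ≤ |(#X : ℝ) / n - (a + lam / 2)|})
    (univ : Finset Bool) (fun b ↦ {X | a * n ≤ #(triVerts X) ∧
      y * ε * n ≤ (if b then y else -y) * (#X - (a + lam / 2) * n)}) 1 h0 h1 ?_
  · simp only [Fintype.sum_bool, Nat.cast_one, one_mul, if_true, Bool.false_eq_true, if_false]
      at hun
    linarith
  · rintro X - ⟨hX, hdev⟩
    have e : (#X : ℝ) - (a + lam / 2) * n = (#X / n - (a + lam / 2)) * n := by field_simp
    rcases le_abs'.1 hdev with h | h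
    · refine ⟨{false}, by simp, by simp, fun b hb ↦ ?_⟩
      rw [mem_singleton.1 hb]
      refine ⟨hX, ?_⟩
      simp only [Bool.false_eq_true, if_false]
      rw [e]
      have := mul_le_mul_of_nonneg_left h (mul_pos hy0 hnR).le
      linarith
    · refine ⟨{true}, by simp, by simp, fun b hb ↦ ?_⟩
      rw [mem_singleton.1 hb]
      refine ⟨hX, ?_⟩
      simp only [if_true]
      rw [e]
      have := mul_le_mul_of_nonneg_left h (mul_pos hy0 hnR).le
      linarith

end Concentration

/-! ### Translation to the binomial random graph -/

section RandomGraph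
open MeasureTheory

instance {V : Type*} [Countable V] : MeasurableSingletonClass (SimpleGraph V) where
  measurableSet_singleton G := by
    convert SimpleGraph.measurable_edgeSet (measurableSet_singleton G.edgeSet)
    ext H
    simp

/-- The set of edges of a graph on a finite vertex set, as a `Finset`. -/
noncomputable def finEdges {V : Type*} [Finite V] (G : SimpleGraph V) : Finset (Sym2 V) :=
  (Set.toFinite G.edgeSet).toFinset

variable {V : Type*} [Fintype V]

lemma mem_finEdges {G : SimpleGraph V} {u v : V} : s(u, v) ∈ finEdges G ↔ G.Adj u v := by
  simp [finEdges]

lemma numEdges_eq_card (G : SimpleGraph V) : numEdges G = #(finEdges G) :=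
  Set.ncard_eq_toFinset_card _ _

variable [DecidableEq V]

lemma numTriangleVertices_eq_card (G : SimpleGraph V) :
    numTriangleVertices G = #(triVerts (finEdges G)) := by
  rw [numTriangleVertices, ← Set.ncard_coe_finset]
  congr 1
  ext v
  simp only [triangleVertices, Set.mem_ofPred_eq, mem_coe, mem_triVerts, mem_trianglesOf]
  constructor
  · rintro ⟨u, w, hvu, hvw, huw⟩
    refine ⟨{v, u, w}, ⟨card_eq_three.2 ⟨v, u, w, hvu.ne, hvw.ne, huw.ne, rfl⟩, ?_⟩, by simp⟩
    rw [pairsIn_triple hvu.ne hvw.ne huw.ne]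
    intro e he
    simp only [mem_insert, mem_singleton] at he
    rcases he with rfl | rfl | rfl <;> rwa [mem_finEdges]
  · rintro ⟨T, ⟨hT, hsub⟩, hv⟩
    obtain ⟨x, y, hvx, hvy, hxy, rfl⟩ := exists_triple_of_mem hT hv
    rw [pairsIn_triple hvx hvy hxy] at hsub
    exact ⟨x, y, mem_finEdges.1 (hsub (by simp)), mem_finEdges.1 (hsub (by simp)),
      mem_finEdges.1 (hsub (by simp))⟩

lemma finEdges_fromEdgeSet {X : Finset (Sym2 V)} (hX : X ⊆ allPairs V) :
    finEdges (SimpleGraph.fromEdgeSet (X : Set (Sym2 V))) = X := by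
  ext e
  induction e with | _ u v
  rw [mem_finEdges, SimpleGraph.fromEdgeSet_adj, mem_coe]
  refine ⟨fun h ↦ h.1, fun h ↦ ⟨h, ?_⟩⟩
  have := hX h
  rw [allPairs, mk_mem_pairsIn] at this
  exact this.2.2

lemma finEdges_subset_allPairs (G : SimpleGraph V) : finEdges G ⊆ allPairs V := by
  intro e
  induction e with | _ u v
  rw [mem_finEdges, allPairs, mk_mem_pairsIn]
  exact fun h ↦ ⟨mem_univ _, mem_univ _, h.ne⟩

/-- The law of the binomial random graph, expressed through finite sums over edge sets. -/
lemma binomialRandom_real_eq (q : unitInterval) (S : Set (Finset (Sym2 V))) :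
    (SimpleGraph.binomialRandom V q).real {G | finEdges G ∈ S} =
      bernoulliProb (allPairs V) q S := by
  classical
  have hfin : {G : SimpleGraph V | finEdges G ∈ S} =
      ((univ.filter fun G : SimpleGraph V ↦ finEdges G ∈ S : Finset _) : Set (SimpleGraph V)) := by
    simp
  rw [hfin, ← sum_measureReal_singleton, bernoulliProb]
  refine sum_bij' (fun G _ ↦ finEdges G) (fun X _ ↦ SimpleGraph.fromEdgeSet (X : Set (Sym2 V)))
    ?_ ?_ ?_ ?_ ?_
  · intro G hG
    rw [mem_filter, mem_powerset]
    exact ⟨finEdges_subset_allPairs G, (mem_filter.1 hG).2⟩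
  · intro X hX
    rw [mem_filter, mem_powerset] at hX
    rw [mem_filter, finEdges_fromEdgeSet hX.1]
    exact ⟨mem_univ _, hX.2⟩
  · intro G _
    simp [finEdges]
  · intro X hX
    rw [mem_filter, mem_powerset] at hX
    exact finEdges_fromEdgeSet hX.1
  · intro G _
    rw [measureReal_def, SimpleGraph.binomialRandom_singleton, card_allPairs,
      Set.ncard_eq_toFinset_card _ (Set.toFinite G.edgeSet), Nat.card_eq_fintype_card]
    simp [finEdges]

end RandomGraph

/-- Conditionally on `V_T(G_n) ≥ a n` (an event of positive probability for all large `n`), the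
number of edges of `G_n` divided by `n` converges in probability to `a + lam / 2`. -/
theorem theorem2p3 (lam : ℝ) (hlam : 0 < lam) (a : ℝ) (ha0 : 0 < a) (ha1 : a ≤ 1) :
    (∀ᶠ n : ℕ in Filter.atTop, 0 < erdosRenyi lam n (manyTriangleVertices a n)) ∧
      ∀ ε : ℝ, 0 < ε →
        Filter.Tendsto
          (fun n : ℕ =>
            ProbabilityTheory.cond (erdosRenyi lam n) (manyTriangleVertices a n)
              {G | ε ≤ |(numEdges G : ℝ) / n - (a + lam / 2)|})
          Filter.atTop (nhds 0) := by
  -- the truncation of the edge probability is inactive for `n ≥ lam`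
  have hlaw : ∀ᶠ n : ℕ in Filter.atTop, ∀ S : Set (Finset (Sym2 (Fin n))),
      (erdosRenyi lam n).real {G | finEdges G ∈ S} =
        bernoulliProb (allPairs (Fin n)) (lam / n) S := by
    filter_upwards [(tendsto_natCast_atTop_atTop (R := ℝ)).eventually_ge_atTop lam,
      Filter.eventually_gt_atTop 0] with n hn hn0 S
    have hnR : (0 : ℝ) < n := Nat.cast_pos.2 hn0
    have hq : ((edgeProb lam n : unitInterval) : ℝ) = lam / n := by
      rw [edgeProb, Set.projIcc_of_mem zero_le_one
        ⟨by positivity, by rw [div_le_one hnR]; exact hn⟩]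
    rw [erdosRenyi, binomialRandom_real_eq, hq]
  have hset : ∀ n : ℕ, manyTriangleVertices a n =
      {G | finEdges G ∈ {X : Finset (Sym2 (Fin n)) | a * n ≤ #(triVerts X)}} := by
    intro n
    ext G
    simp [manyTriangleVertices, numTriangleVertices_eq_card]
  have hpos : ∀ᶠ n : ℕ in Filter.atTop,
      0 < bernoulliProb (allPairs (Fin n)) (lam / n) {X | a * n ≤ #(triVerts X)} := by
    filter_upwards [(tendsto_natCast_atTop_atTop (R := ℝ)).eventually_ge_atTop lam,
      Filter.eventually_ge_atTop 3] with n hn hn3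
    have hnR : (0 : ℝ) < n := Nat.cast_pos.2 (by omega)
    have h := card_allPairs_pow_le_bernoulliProb (V := Fin n) (p := lam / n) (by positivity)
      (by rw [div_le_one hnR]; exact hn) (by simpa using hn3) (t := n) (by simp)
    refine lt_of_lt_of_le (by positivity) (h.trans (bernoulliProb_mono (by positivity)
      (by rw [div_le_one hnR]; exact hn) fun X _ hX ↦ ?_))
    have hX' : (n : ℝ) ≤ #(triVerts X) := by exact_mod_cast hX
    exact (mul_le_of_le_one_left hnR.le ha1).trans hX'
  have hprob : ∀ n : ℕ, MeasureTheory.IsProbabilityMeasure (erdosRenyi lam n) := fun n ↦ by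
    unfold erdosRenyi; infer_instance
  refine ⟨?_, fun ε hε ↦ ?_⟩
  · filter_upwards [hlaw, hpos] with n hlaw hpos
    rw [← hlaw, ← hset] at hpos
    exact (ENNReal.toReal_pos_iff.1 hpos).1
  · obtain ⟨c, hc, hdev⟩ := eventually_bernoulliProb_deviation_le hlam ha0 ha1 hε
    have hlim : Filter.Tendsto (fun n : ℕ ↦ ENNReal.ofReal (2 * Real.exp (-c * n)))
        Filter.atTop (nhds 0) := by
      rw [← ENNReal.ofReal_zero]
      refine ENNReal.tendsto_ofReal ?_
      rw [← mul_zero (2 : ℝ)]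
      refine (Real.tendsto_exp_atBot.comp ?_).const_mul 2
      exact tendsto_natCast_atTop_atTop.const_mul_atTop_of_neg (by linarith)
    refine tendsto_of_tendsto_of_tendsto_of_le_of_le' tendsto_const_nhds hlim
      (Filter.Eventually.of_forall fun _ ↦ zero_le) ?_
    filter_upwards [hlaw, hpos, hdev] with n hlaw hpos hdev
    rw [← hlaw, ← hset] at hpos
    rw [← hlaw, ← hlaw, ← hset] at hdev
    have hinter : manyTriangleVertices a n ∩ {G | ε ≤ |(numEdges G : ℝ) / n - (a + lam / 2)|} =
        {G | finEdges G ∈ {X : Finset (Sym2 (Fin n)) | a * n ≤ #(triVerts X) ∧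
          ε ≤ |(#X : ℝ) / n - (a + lam / 2)|}} := by
      rw [hset]
      ext G
      simp [numEdges_eq_card]
    rw [← hinter, MeasureTheory.measureReal_def, MeasureTheory.measureReal_def] at hdev
    rw [MeasureTheory.measureReal_def] at hpos
    rw [ProbabilityTheory.cond_apply (Set.toFinite _).measurableSet,
      ← ENNReal.ofReal_toReal (MeasureTheory.measure_ne_top (erdosRenyi lam n)
        (manyTriangleVertices a n ∩ _)),
      ← ENNReal.ofReal_toReal (MeasureTheory.measure_ne_top (erdosRenyi lam n)
        (manyTriangleVertices a n)), ← ENNReal.ofReal_inv_of_pos hpos,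
      ← ENNReal.ofReal_mul (by positivity)]
    refine ENNReal.ofReal_le_ofReal ?_
    rw [inv_mul_le_iff₀ hpos, mul_comm]
    exact hdev
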